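/- **Theorem (first no-hair theorem).** Let $\mathfrak g$ be a three-dimensional real solvable Lie algebra (equivalently, of one of the Bianchi types I–VII$_h$), $G$ a Lie group with Lie algebra $\mathfrak g$, and consider on $(t_0,\infty)\times G$ a spatially homogeneous metric $$ds^2=-dt^2+\delta_{ab}\,\omega^a\omega^b ,$$ where, for each $t$, $(\omega^a)$ is the coframe dual to a basis $e_1(t),e_2(t),e_3(t)$ of left-invariant vector fields on $G$ that depends on $t$ in a $C^2$ way; put $e_0=\partial_t$. Let $j\in\{1,3\}$, $\gamma\ge 0$ and $\Lambda>0$. Suppose that for all $t>t_0$ the Einstein equations (with $8\pi G=c=1$) $$R_{\mu\nu}-\tfrac12 R\,g_{\mu\nu}=T^{\rm pf}_{\mu\nu}+T^{\rm jf}_{\mu\nu}-\Lambda g_{\mu\nu}$$ hold, where all matter fields are $C^1$ and homogeneous (their components in the frame $(e_\mu)$ depend on $t$ only), and * $T^{\rm jf}_{\mu\nu}=\frac{1}{(j-1)!}\mathcal P_{\mu\alpha_2\cdots\alpha_j}\mathcal P_{\nu}{}^{\alpha_2\cdots\alpha_j}-\frac{1}{2\,j!}\,g_{\mu\nu}\,\mathcal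 P_{\alpha_1\cdots\alpha_j}\mathcal P^{\alpha_1\cdots\alpha_j}$ is the energy-momentum tensor of a $j$-form $\mathcal P$ with $d\mathcal P=0$ and $d{\star}\mathcal P=0$; * $T^{\rm pf}_{\mu\nu}=(\rho+p)U_\mu U_\nu+p\,g_{\mu\nu}$ is that of a perfect fluid with $p=(\gamma-1)\rho$, $\rho\ge0$, $U_\mu U^\mu=-1$ ($U=e_0$ or not), which does not interact with the other matter: $\nabla^\mu T^{\rm pf}_{\mu\nu}=0$. Let $H=\frac13\nabla_\mu e_0{}^\mu$ be the Hubble parameter, $\sigma_{ab}$ the shear of the observers $e_0$ (the trace-free part of $\nabla_a (e_0)_b$), $q$ the deceleration parameter, $\dot H=-(1+q)H^2$, and $\Omega_\Lambda=\Lambda/(3H^2)$, $\Omega_{\rm pf}=T^{\rm pf}(e_0,e_0)/(3H^2)$. Then the space-time is asymptotically de Sitter: as $t\to\infty$, the components $R_{\rho\sigma\mu\nu}$ of the Riemann tensor in the orthonormal frame $(e_\mu)$ tend to $K(g_{\rho\mu}g_{\sigma\nu}-g_{\rho\nu}g_{\sigma\mu})$ for some constant $K>0$, $\sigma_{ab}/H\to0$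 and $q\to-1$. Moreover $\Omega_\Lambda\to1$ if $\gamma>0$, and $\Omega_\Lambda+\Omega_{\rm pf}\to1$ if $\gamma=0$. -/

import Mathlib

/-!
Spatially homogeneous space-times `(t₀, ∞) × G`, `G` a three-dimensional Lie group with Lie
algebra `𝔤`, are described by an orthonormal frame `e₀ = ∂/∂t`, `e₁, e₂, e₃`, where for each `t`
the left-invariant spatial vectors `e₁(t), e₂(t), e₃(t)` form a basis of `𝔤`. The metric is the
one for which the frame is orthonormal, `ds² = - dt² + δ_ab ω^a ω^b` with `ω^a` the dual coframe.
Homogeneous tensor fields have frame components that depend on `t` only. Space-time indices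
are elements of `Fin 4`, with `0` the time index; spatial indices `a : Fin 3` enter as `a.succ`.
-/

open Filter Topology

namespace Bianchi

noncomputable section

/-- The diagonal entries of the Minkowski metric, signature `(-,+,+,+)`. -/
def etaDiag : Fin 4 → ℝ := ![-1, 1, 1, 1]

/-- The frame components `g_{μν}` (and `g^{μν}`) of the metric in the orthonormal frame. -/
def eta (μ ν : Fin 4) : ℝ := if μ = ν then etaDiag μ else 0

section Geometry

variable {𝔤 : Type*} [LieRing 𝔤] [LieAlgebra ℝ 𝔤]

/-- `γ^a_{0b}`, given by `[e₀, e_b] = ∂_t e_b = γ^a_{0b} e_a`. -/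
def timeCoeff (e : ℝ → Module.Basis (Fin 3) ℝ 𝔤) (t : ℝ) (a b : Fin 3) : ℝ :=
  deriv (fun s => (e t).coord a (e s b)) t

/-- `γ^a_{bc}`, given by `[e_b, e_c] = γ^a_{bc} e_a`. -/
def spaceCoeff (e : ℝ → Module.Basis (Fin 3) ℝ 𝔤) (t : ℝ) (a b c : Fin 3) : ℝ :=
  (e t).coord a ⁅e t b, e t c⁆

/-- The commutation functions `γ^ρ_{μν}` of the space-time frame,
`[e_μ, e_ν] = γ^ρ_{μν} e_ρ`. -/
def commCoeff (e : ℝ → Module.Basis (Fin 3) ℝ 𝔤) (t : ℝ) (ρ μ ν : Fin 4) : ℝ :=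
  Fin.cases (motive := fun _ => ℝ) 0
    (fun a => Fin.cases (motive := fun _ => ℝ)
      (Fin.cases (motive := fun _ => ℝ) 0 (fun b => timeCoeff e t a b) ν)
      (fun b => Fin.cases (motive := fun _ => ℝ) (-timeCoeff e t a b)
        (fun c => spaceCoeff e t a b c) ν) μ) ρ

/-- The frame derivative `e_μ(f)` of a homogeneous function `f`. -/
def frameDeriv (μ : Fin 4) (f : ℝ → ℝ) (t : ℝ) : ℝ := if μ = 0 then deriv f t else 0

/-- The Levi-Civita connection, `∇_{e_μ} e_ν = Γ^λ_{μν} e_λ` with `Γ^λ_{μν} = conn e t λ μ ν`,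
from the Koszul formula in an orthonormal frame. -/
def conn (e : ℝ → Module.Basis (Fin 3) ℝ 𝔤) (t : ℝ) (l μ ν : Fin 4) : ℝ :=
  (commCoeff e t l μ ν
    - etaDiag l * (etaDiag ν * commCoeff e t ν μ l + etaDiag μ * commCoeff e t μ ν l)) / 2

/-- The Riemann tensor, `R(e_μ, e_ν) e_σ = R^ρ_{σμν} e_ρ`, where
`R(X, Y) = ∇_X ∇_Y - ∇_Y ∇_X - ∇_{[X, Y]}`. -/
def riemann (e : ℝ → Module.Basis (Fin 3) ℝ 𝔤) (t : ℝ) (ρ σ μ ν : Fin 4) : ℝ :=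
  frameDeriv μ (fun s => conn e s ρ ν σ) t - frameDeriv ν (fun s => conn e s ρ μ σ) t
    + ∑ l, (conn e t ρ μ l * conn e t l ν σ - conn e t ρ ν l * conn e t l μ σ
      - commCoeff e t l μ ν * conn e t ρ l σ)

/-- The Ricci tensor `R_{σν} = R^ρ_{σρν}`. -/
def ricci (e : ℝ → Module.Basis (Fin 3) ℝ 𝔤) (t : ℝ) (σ ν : Fin 4) : ℝ :=
  ∑ ρ, riemann e t ρ σ ρ ν

/-- The Ricci scalar. -/
def scalarCurv (e : ℝ → Module.Basis (Fin 3) ℝ 𝔤) (t : ℝ) : ℝ :=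
  ∑ μ, etaDiag μ * ricci e t μ μ

/-- The Einstein tensor `R_{μν} - R g_{μν} / 2`. -/
def einstein (e : ℝ → Module.Basis (Fin 3) ℝ 𝔤) (t : ℝ) (μ ν : Fin 4) : ℝ :=
  ricci e t μ ν - scalarCurv e t * eta μ ν / 2

/-- The covariant derivative `(∇_α S)_{m₁ … m_n}` of a homogeneous covariant tensor field `S`
of rank `n`. -/
def covDeriv (e : ℝ → Module.Basis (Fin 3) ℝ 𝔤) {n : ℕ} (S : ℝ → (Fin n → Fin 4) → ℝ)
    (t : ℝ) (α : Fin 4) (m : Fin n → Fin 4) : ℝ :=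
  frameDeriv α (fun s => S s m) t
    - ∑ k, ∑ l, conn e t l α (m k) * S t (Function.update m k l)

/-- The divergence `∇^α S_{α m₁ … m_n}`. -/
def divergence (e : ℝ → Module.Basis (Fin 3) ℝ 𝔤) {n : ℕ}
    (S : ℝ → (Fin (n + 1) → Fin 4) → ℝ) (t : ℝ) (m : Fin n → Fin 4) : ℝ :=
  ∑ α, etaDiag α * covDeriv e S t α (Fin.cons α m)

/-- The exterior derivative of a form `P` of degree `n`,
`(dP)_{m₀ … m_n} = ∑ₖ (-1)^k (∇_{m_k} P)_{m₀ … m̂_k … m_n}`, i.e. `(n + 1) ∇_{[m₀} P_{m₁ … m_n]}`. -/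
def extDeriv (e : ℝ → Module.Basis (Fin 3) ℝ 𝔤) {n : ℕ} (P : ℝ → (Fin n → Fin 4) → ℝ)
    (t : ℝ) (m : Fin (n + 1) → Fin 4) : ℝ :=
  ∑ k : Fin (n + 1), (-1) ^ (k : ℕ) * covDeriv e P t (m k) (fun i => m (k.succAbove i))

/-- The Hubble parameter `H = ∇_μ u^μ / 3` of the observers `u = e₀`. -/
def hubble (e : ℝ → Module.Basis (Fin 3) ℝ 𝔤) (t : ℝ) : ℝ :=
  (∑ μ, conn e t μ μ 0) / 3

/-- The shear `σ_{ab}` of the observers `u = e₀`: the trace-free part of `∇_a u_b`, which is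
symmetric since the space-time is hypersurface-orthogonal to `u`. -/
def shear (e : ℝ → Module.Basis (Fin 3) ℝ 𝔤) (t : ℝ) (a b : Fin 3) : ℝ :=
  conn e t b.succ a.succ 0 - (if a = b then hubble e t else 0)

/-- The deceleration parameter, defined by `dH/dt = -(1 + q) H²`. -/
def deceleration (e : ℝ → Module.Basis (Fin 3) ℝ 𝔤) (t : ℝ) : ℝ :=
  -1 - deriv (hubble e) t / hubble e t ^ 2

/-- The space-time is asymptotically de Sitter: in the orthonormal frame the Riemann tensor
`R_{ρσμν}` tends to that of a de Sitter space-time, `K (g_{ρμ} g_{σν} - g_{ρν} g_{σμ})` with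
`K > 0`, the Hubble-normalized shear of the observers `e₀` tends to `0` and the deceleration
parameter tends to `-1`. -/
def AsymptoticallyDeSitter (e : ℝ → Module.Basis (Fin 3) ℝ 𝔤) : Prop :=
  (∃ K : ℝ, 0 < K ∧ ∀ ρ σ μ ν : Fin 4,
    Tendsto (fun t => etaDiag ρ * riemann e t ρ σ μ ν) atTop
      (𝓝 (K * (eta ρ μ * eta σ ν - eta ρ ν * eta σ μ)))) ∧
  (∀ a b : Fin 3, Tendsto (fun t => shear e t a b / hubble e t) atTop (𝓝 0)) ∧
  Tendsto (deceleration e) atTop (𝓝 (-1))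

end Geometry

section Matter

/-- The energy-momentum tensor of a form field strength `P` of degree `q + 1` with action
`-1/2 ∫ P ∧ ⋆P`:
`T_{μν} = (1/q!) P_{μ α₁ … α_q} P_ν^{α₁ … α_q} - (1/(2 (q+1)!)) g_{μν} P_{α₀ … α_q} P^{α₀ … α_q}`.
For `q = 0` this is `J_μ J_ν - g_{μν} J_α J^α / 2`. -/
def formT {q : ℕ} (P : ℝ → (Fin (q + 1) → Fin 4) → ℝ) (t : ℝ) (μ ν : Fin 4) : ℝ :=
  (1 / (Nat.factorial q : ℝ)) * (∑ n : Fin q → Fin 4,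
      (∏ i, etaDiag (n i)) * (P t (Fin.cons μ n) * P t (Fin.cons ν n)))
    - (1 / (2 * (Nat.factorial (q + 1) : ℝ))) * eta μ ν *
      ∑ m : Fin (q + 1) → Fin 4, (∏ i, etaDiag (m i)) * P t m ^ 2

/-- The energy-momentum tensor `(ρ + p) U_μ U_ν + p g_{μν}`, `p = (γ - 1) ρ`, of a perfect
fluid with energy density `ρ` and four-velocity `U^μ`. -/
def fluidT (γ : ℝ) (ρ : ℝ → ℝ) (U : ℝ → Fin 4 → ℝ) (t : ℝ) (μ ν : Fin 4) : ℝ :=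
  γ * ρ t * ((etaDiag μ * U t μ) * (etaDiag ν * U t ν)) + (γ - 1) * ρ t * eta μ ν

end Matter

section Model

variable {𝔤 : Type*} [LieRing 𝔤] [LieAlgebra ℝ 𝔤]

/-- The space-time with orthonormal frame `e`, a form field strength `P` of degree `q + 1`, a
perfect fluid `(ρ, U)` with equation of state `p = (γ - 1) ρ` and the cosmological constant `Λ`
solve the Einstein equations (with `8πG = c = 1`) for `t > t₀`; the form field obeys its free
field equations and the fluid does not interact with the other matter. -/
structure IsCosmology (γ Λ t₀ : ℝ) {q : ℕ} (e : ℝ → Module.Basis (Fin 3) ℝ 𝔤)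
    (P : ℝ → (Fin (q + 1) → Fin 4) → ℝ) (ρ : ℝ → ℝ) (U : ℝ → Fin 4 → ℝ) : Prop where
  frame_contDiff : ∀ (φ : Module.Dual ℝ 𝔤) (a : Fin 3),
    ContDiffOn ℝ 2 (fun t => φ (e t a)) (Set.Ioi t₀)
  form_contDiff : ∀ m, ContDiffOn ℝ 1 (fun t => P t m) (Set.Ioi t₀)
  density_contDiff : ContDiffOn ℝ 1 ρ (Set.Ioi t₀)
  velocity_contDiff : ∀ μ, ContDiffOn ℝ 1 (fun t => U t μ) (Set.Ioi t₀)
  form_alternating : ∀ t > t₀, ∀ (m : Fin (q + 1) → Fin 4) (s : Equiv.Perm (Fin (q + 1))),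
    P t (m ∘ s) = ((Equiv.Perm.sign s : ℤ) : ℝ) * P t m
  form_closed : ∀ t > t₀, ∀ m, extDeriv e P t m = 0
  form_coclosed : ∀ t > t₀, ∀ m, divergence e P t m = 0
  density_nonneg : ∀ t > t₀, 0 ≤ ρ t
  velocity_unit : ∀ t > t₀, ∑ μ, etaDiag μ * U t μ ^ 2 = -1
  fluid_conserved : ∀ t > t₀, ∀ m,
    divergence e (n := 1) (fun s i => fluidT γ ρ U s (i 0) (i 1)) t m = 0
  einstein_eq : ∀ t > t₀, ∀ μ ν,
    einstein e t μ ν = fluidT γ ρ U t μ ν + formT P t μ ν - Λ * eta μ ν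

/-- `Ω_Λ = Λ / (3 H²)`. -/
def omegaLambda (Λ : ℝ) (e : ℝ → Module.Basis (Fin 3) ℝ 𝔤) (t : ℝ) : ℝ :=
  Λ / (3 * hubble e t ^ 2)

/-- `Ω_pf`, the energy density of the fluid relative to the observers `e₀`, divided by `3 H²`.
It is `ρ / (3 H²)` if the fluid is comoving with them. -/
def omegaFluid (γ : ℝ) (ρ : ℝ → ℝ) (U : ℝ → Fin 4 → ℝ) (e : ℝ → Module.Basis (Fin 3) ℝ 𝔤)
    (t : ℝ) : ℝ :=
  fluidT γ ρ U t 0 0 / (3 * hubble e t ^ 2)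

end Model

end

end Bianchi

namespace Bianchi

section Connection

variable {𝔤 : Type*} [LieRing 𝔤] [LieAlgebra ℝ 𝔤] (e : ℝ → Module.Basis (Fin 3) ℝ 𝔤) (t : ℝ)

/-- The expansion tensor `θ_{ab} = ∇_a u_b` of the observers `u = e₀`. -/
noncomputable def expansion (a b : Fin 3) : ℝ := -(timeCoeff e t a b + timeCoeff e t b a) / 2

/-- The rotation of the spatial frame relative to a Fermi-propagated one. -/
noncomputable def frameRotation (a b : Fin 3) : ℝ :=
  (timeCoeff e t a b - timeCoeff e t b a) / 2

/-- The Levi-Civita connection of a left-invariant metric with structure constants `c` in an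
orthonormal frame. -/
noncomputable def spatialConn (c : Fin 3 → Fin 3 → Fin 3 → ℝ) (a b d : Fin 3) : ℝ :=
  (c a b d - (c d b a + c b d a)) / 2

/-- The Riemann tensor `³R^a_{bcd}` of a left-invariant metric with structure constants `c` in an
orthonormal frame. -/
noncomputable def spatialRiemann (c : Fin 3 → Fin 3 → Fin 3 → ℝ) (a b i j : Fin 3) : ℝ :=
  ∑ l, (spatialConn c a i l * spatialConn c l j b - spatialConn c a j l * spatialConn c l i b
    - c l i j * spatialConn c a l b)

/-- The Ricci scalar of a left-invariant metric with structure constants `c` in an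
orthonormal frame. -/
noncomputable def spatialScalar (c : Fin 3 → Fin 3 → Fin 3 → ℝ) : ℝ :=
  ∑ a, ∑ b, spatialRiemann c b a b a

@[simp] lemma etaDiag_zero : etaDiag 0 = -1 := rfl

@[simp] lemma etaDiag_succ (a : Fin 3) : etaDiag a.succ = 1 := by
  fin_cases a <;> rfl

@[simp] lemma commCoeff_zero (μ ν : Fin 4) : commCoeff e t 0 μ ν = 0 := rfl

@[simp] lemma commCoeff_zero_zero (ρ : Fin 4) : commCoeff e t ρ 0 0 = 0 := by
  cases ρ using Fin.cases <;> rfl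

@[simp] lemma commCoeff_succ_zero_succ (a b : Fin 3) :
    commCoeff e t a.succ 0 b.succ = timeCoeff e t a b := rfl

@[simp] lemma commCoeff_succ_succ_zero (a b : Fin 3) :
    commCoeff e t a.succ b.succ 0 = -timeCoeff e t a b := rfl

@[simp] lemma commCoeff_succ (a b c : Fin 3) :
    commCoeff e t a.succ b.succ c.succ = spaceCoeff e t a b c := rfl

lemma spaceCoeff_antisymm (a b c : Fin 3) : spaceCoeff e t a b c = -spaceCoeff e t a c b := by
  rw [spaceCoeff, ← lie_skew, map_neg, spaceCoeff]

lemma commCoeff_antisymm (ρ μ ν : Fin 4) : commCoeff e t ρ μ ν = -commCoeff e t ρ ν μ := by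
  cases ρ using Fin.cases <;> cases μ using Fin.cases <;> cases ν using Fin.cases <;> simp
  exact spaceCoeff_antisymm ..

lemma etaDiag_mul_self (μ : Fin 4) : etaDiag μ * etaDiag μ = 1 := by
  cases μ using Fin.cases <;> simp

@[simp] lemma conn_zero_zero (ν : Fin 4) : conn e t 0 0 ν = 0 := by
  cases ν using Fin.cases <;> simp [conn]

@[simp] lemma conn_zero_right_zero (μ : Fin 4) : conn e t 0 μ 0 = 0 := by
  cases μ using Fin.cases <;> simp [conn]

@[simp] lemma conn_right_zero_zero (l : Fin 4) : conn e t l 0 0 = 0 := by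
  cases l using Fin.cases <;> simp [conn]

@[simp] lemma conn_zero_succ_succ (a b : Fin 3) :
    conn e t 0 a.succ b.succ = expansion e t a b := by
  simp [conn, expansion]

@[simp] lemma conn_succ_succ_zero (a b : Fin 3) :
    conn e t a.succ b.succ 0 = expansion e t a b := by
  simp [conn, expansion]; ring

@[simp] lemma conn_succ_zero_succ (a b : Fin 3) :
    conn e t a.succ 0 b.succ = frameRotation e t a b := by
  simp [conn, frameRotation]

@[simp] lemma conn_succ (a b c : Fin 3) :
    conn e t a.succ b.succ c.succ = spatialConn (spaceCoeff e t) a b c := by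
  simp [conn, spatialConn]

lemma conn_antisymm (l μ ν : Fin 4) :
    etaDiag l * conn e t l μ ν = -(etaDiag ν * conn e t ν μ l) := by
  have h1 := commCoeff_antisymm e t μ ν l
  have h2 := etaDiag_mul_self l
  have h3 := etaDiag_mul_self ν
  simp only [conn]
  linear_combination (-(etaDiag ν * commCoeff e t ν μ l + etaDiag μ * commCoeff e t μ ν l) / 2) * h2
    + (-(etaDiag l * commCoeff e t l μ ν + etaDiag μ * commCoeff e t μ l ν) / 2) * h3
    - etaDiag μ / 2 * h1

lemma expansion_symm (a b : Fin 3) : expansion e t a b = expansion e t b a := by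
  simp only [expansion]; ring

lemma hubble_eq : hubble e t = (∑ a, expansion e t a a) / 3 := by
  simp [hubble, Fin.sum_univ_succ (n := 3)]

lemma shear_eq (a b : Fin 3) :
    shear e t a b = expansion e t a b - if a = b then hubble e t else 0 := by
  simp [shear, expansion_symm e t b a]

lemma riemann_antisymm_right (ρ σ μ ν : Fin 4) :
    riemann e t ρ σ μ ν = -riemann e t ρ σ ν μ := by
  simp only [riemann, neg_add, ← Finset.sum_neg_distrib]
  congr 1
  · ring
  · refine Finset.sum_congr rfl fun l _ => ?_
    rw [commCoeff_antisymm e t l μ ν]; ring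

lemma frameDeriv_const_mul (μ : Fin 4) (k : ℝ) (f : ℝ → ℝ) :
    frameDeriv μ (fun s => k * f s) t = k * frameDeriv μ f t := by
  unfold frameDeriv
  split_ifs <;> simp

lemma riemann_antisymm_left (ρ σ μ ν : Fin 4) :
    etaDiag ρ * riemann e t ρ σ μ ν = -(etaDiag σ * riemann e t σ ρ μ ν) := by
  have hf : ∀ α β, etaDiag ρ * frameDeriv α (fun s => conn e s ρ β σ) t
      = -(etaDiag σ * frameDeriv α (fun s => conn e s σ β ρ) t) := by
    intro α β
    rw [← frameDeriv_const_mul, ← neg_mul, ← frameDeriv_const_mul]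
    congr 1
    funext s
    rw [conn_antisymm, neg_mul]
  have hs : ∀ α β l, etaDiag ρ * (conn e t ρ α l * conn e t l β σ)
      = etaDiag σ * (conn e t σ β l * conn e t l α ρ) := by
    intro α β l
    have h1 := conn_antisymm e t ρ α l
    have h2 := conn_antisymm e t l β σ
    calc etaDiag ρ * (conn e t ρ α l * conn e t l β σ)
        = (etaDiag ρ * conn e t ρ α l) * conn e t l β σ := by ring
      _ = -(etaDiag l * conn e t l β σ) * conn e t l α ρ := by rw [h1]; ring
      _ = _ := by rw [h2]; ring
  simp only [riemann, mul_add, mul_sub, neg_add, Finset.mul_sum, neg_sub, ← Finset.sum_neg_distrib,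
    hf, hs]
  congr 1
  · ring
  · refine Finset.sum_congr rfl fun l _ => ?_
    have h := conn_antisymm e t ρ l σ
    linear_combination (-commCoeff e t l μ ν) * h

lemma riemann_self_left (ρ μ ν : Fin 4) : riemann e t ρ ρ μ ν = 0 := by
  have h := riemann_antisymm_left e t ρ ρ μ ν
  have h2 := etaDiag_mul_self ρ
  have h3 : etaDiag ρ * riemann e t ρ ρ μ ν = 0 := by linarith
  linear_combination etaDiag ρ * h3 - riemann e t ρ ρ μ ν * h2

lemma riemann_self_right (ρ σ μ : Fin 4) : riemann e t ρ σ μ μ = 0 := by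
  have h := riemann_antisymm_right e t ρ σ μ μ
  linarith

@[simp] lemma frameDeriv_succ (a : Fin 3) (f : ℝ → ℝ) : frameDeriv a.succ f t = 0 := by
  simp [frameDeriv, Fin.succ_ne_zero]

@[simp] lemma frameDeriv_zero (f : ℝ → ℝ) : frameDeriv 0 f t = deriv f t := by
  simp [frameDeriv]

/-- The Gauss equation. -/
lemma riemann_spatial (a b i j : Fin 3) :
    riemann e t a.succ b.succ i.succ j.succ = spatialRiemann (spaceCoeff e t) a b i j
      + (expansion e t a i * expansion e t j b - expansion e t a j * expansion e t i b) := by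
  simp [riemann, Fin.sum_univ_succ (n := 3), spatialRiemann]
  ring

/-- The Codazzi equation. -/
lemma riemann_codazzi (a i j : Fin 3) :
    riemann e t a.succ 0 i.succ j.succ =
      ∑ l, (spatialConn (spaceCoeff e t) a i l * expansion e t l j
        - spatialConn (spaceCoeff e t) a j l * expansion e t l i
        - spaceCoeff e t l i j * expansion e t a l) := by
  simp [riemann, Fin.sum_univ_succ (n := 3)]

lemma riemann_mixed (a b j : Fin 3) :
    riemann e t a.succ b.succ 0 j.succ =
      deriv (fun s => spatialConn (spaceCoeff e s) a j b) t
      + ∑ l, (frameRotation e t a l * spatialConn (spaceCoeff e t) l j b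
        - spatialConn (spaceCoeff e t) a j l * frameRotation e t l b
        - timeCoeff e t l j * spatialConn (spaceCoeff e t) a l b) := by
  simp [riemann, Fin.sum_univ_succ (n := 3)]

lemma riemann_electric (a b : Fin 3) :
    riemann e t a.succ 0 b.succ 0 = -deriv (fun s => expansion e s a b) t
      + ∑ l, (timeCoeff e t l b * expansion e t a l
        - frameRotation e t a l * expansion e t l b) := by
  simp [riemann, Fin.sum_univ_succ (n := 3), Finset.sum_add_distrib]
  ring

lemma ricci_spatial (a b : Fin 3) :
    ricci e t a.succ b.succ = -riemann e t a.succ 0 b.succ 0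
      + ∑ c : Fin 3, riemann e t c.succ a.succ c.succ b.succ := by
  have h := riemann_antisymm_left e t 0 a.succ 0 b.succ
  have h2 := riemann_antisymm_right e t a.succ 0 0 b.succ
  rw [ricci, Fin.sum_univ_succ]
  simp at h
  rw [h, h2]

lemma ricci_zero_zero : ricci e t 0 0 = ∑ a : Fin 3, riemann e t a.succ 0 a.succ 0 := by
  rw [ricci, Fin.sum_univ_succ, riemann_self_left, zero_add]

lemma scalarCurv_eq : scalarCurv e t = -ricci e t 0 0 + ∑ a : Fin 3, ricci e t a.succ a.succ := by
  simp [scalarCurv, Fin.sum_univ_succ (n := 3)]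

lemma einstein_zero_zero : einstein e t 0 0 =
    (spatialScalar (spaceCoeff e t) + 9 * hubble e t ^ 2
      - ∑ a, ∑ b, expansion e t a b ^ 2) / 2 := by
  have h : ∑ a : Fin 3, ∑ b : Fin 3, riemann e t b.succ a.succ b.succ a.succ =
      spatialScalar (spaceCoeff e t) + 9 * hubble e t ^ 2 - ∑ a, ∑ b, expansion e t a b ^ 2 := by
    simp only [riemann_spatial, spatialScalar, Finset.sum_add_distrib, hubble_eq]
    simp only [Fin.sum_univ_three, expansion_symm e t 1 0, expansion_symm e t 2 0,
      expansion_symm e t 2 1]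
    ring
  rw [einstein, scalarCurv_eq]
  simp only [ricci_spatial, Finset.sum_add_distrib, h, ricci_zero_zero]
  simp [eta, Finset.sum_neg_distrib]
  ring

/-- The trace-reversed Einstein equations for `R₀₀`. -/
lemma ricci_zero_zero_of_einstein :
    ricci e t 0 0 = (einstein e t 0 0 + ∑ a : Fin 3, einstein e t a.succ a.succ) / 2 := by
  simp only [einstein, scalarCurv_eq]
  simp [eta, Fin.sum_univ_three]
  ring

lemma ricci_spatial_of_einstein (a b : Fin 3) :
    ricci e t a.succ b.succ = einstein e t a.succ b.succ
      - (if a = b then (-einstein e t 0 0 + ∑ c : Fin 3, einstein e t c.succ c.succ) / 2 else 0)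
        := by
  simp only [einstein, scalarCurv_eq]
  by_cases hab : a = b
  · subst hab
    simp [eta, Fin.sum_univ_three]
    ring
  · simp [eta, hab]

end Connection

section Smoothness

variable {𝔤 : Type*} [LieRing 𝔤] [LieAlgebra ℝ 𝔤] {e : ℝ → Module.Basis (Fin 3) ℝ 𝔤} {t₀ : ℝ}

lemma frame_coord_mul (B : Module.Basis (Fin 3) ℝ 𝔤) (s : ℝ) (a b : Fin 3) :
    ∑ d, (e s).coord a (B d) * B.coord d (e s b) = if a = b then 1 else 0 := by
  have h := congrFun (congrFun (Module.Basis.toMatrix_mul_toMatrix_flip (e s) B) a) b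
  simpa [Matrix.mul_apply, Module.Basis.toMatrix_apply, Matrix.one_apply] using h

lemma coord_eq_sum (B C : Module.Basis (Fin 3) ℝ 𝔤) (a : Fin 3) (v : 𝔤) :
    C.coord a v = ∑ d, C.coord a (B d) * B.coord d v := by
  conv_lhs => rw [← B.sum_repr v]
  simp only [map_sum, map_smul, smul_eq_mul, Module.Basis.coord_apply, mul_comm]

lemma contDiffOn_dual_frame
    (he : ∀ (φ : Module.Dual ℝ 𝔤) (a : Fin 3), ContDiffOn ℝ 2 (fun t => φ (e t a)) (Set.Ioi t₀))
    (a : Fin 3) (v : 𝔤) : ContDiffOn ℝ 2 (fun t => (e t).coord a v) (Set.Ioi t₀) := by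
  obtain ⟨B⟩ : Nonempty (Module.Basis (Fin 3) ℝ 𝔤) := ⟨e 0⟩
  have hM : ∀ i j, ContDiffOn ℝ 2 (fun t => B.toMatrix (e t) i j) (Set.Ioi t₀) := fun i j =>
    he (B.coord i) j
  have hmul : ∀ t, B.toMatrix (e t) * (e t).toMatrix B = 1 := fun t =>
    Module.Basis.toMatrix_mul_toMatrix_flip B (e t)
  have hdet0 : ∀ t, (B.toMatrix (e t)).det ≠ 0 := fun t h => by
    have := congrArg Matrix.det (hmul t)
    rw [Matrix.det_mul, h] at this
    simp at this
  have hdet : ContDiffOn ℝ 2 (fun t => (B.toMatrix (e t)).det) (Set.Ioi t₀) := by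
    simp only [Matrix.det_fin_three]
    fun_prop
  have hadj : ∀ i j, ContDiffOn ℝ 2 (fun t => (B.toMatrix (e t)).adjugate i j) (Set.Ioi t₀) := by
    intro i j
    simp only [Matrix.adjugate_fin_three]
    fin_cases i <;> fin_cases j <;> simp <;> fun_prop
  have hinv : ∀ t i, (e t).coord a (B i)
      = ((B.toMatrix (e t)).det)⁻¹ * (B.toMatrix (e t)).adjugate a i := by
    intro t i
    have h := Matrix.inv_eq_right_inv (hmul t)
    rw [Matrix.inv_def] at h
    have := congrFun (congrFun h a) i
    simp only [Matrix.smul_apply, smul_eq_mul, Ring.inverse_eq_inv'] at this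
    rw [this, Module.Basis.toMatrix_apply, Module.Basis.coord_apply]
  have : (fun t => (e t).coord a v) = fun t => ∑ d,
      ((B.toMatrix (e t)).det)⁻¹ * (B.toMatrix (e t)).adjugate a d * B.coord d v := by
    funext t
    rw [coord_eq_sum B (e t)]
    simp only [hinv]
  rw [this]
  refine ContDiffOn.sum fun d _ => ContDiffOn.mul (ContDiffOn.mul ?_ (hadj a d)) contDiffOn_const
  exact hdet.inv fun t _ => hdet0 t

lemma timeCoeff_eq_sum {t : ℝ}
    (he : ∀ (φ : Module.Dual ℝ 𝔤) (a : Fin 3), ContDiffOn ℝ 2 (fun t => φ (e t a)) (Set.Ioi t₀))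
    (ht : t₀ < t) (B : Module.Basis (Fin 3) ℝ 𝔤) (a b : Fin 3) :
    timeCoeff e t a b =
      ∑ d, (e t).coord a (B d) * deriv (fun s => B.coord d (e s b)) t := by
  have hd : ∀ d, DifferentiableAt ℝ (fun s => B.coord d (e s b)) t := fun d =>
    ((he (B.coord d) b).differentiableOn (by norm_num)).differentiableAt (Ioi_mem_nhds ht)
  rw [timeCoeff]
  simp only [fun s => coord_eq_sum B (e t) a (e s b)]
  rw [deriv_fun_sum fun d _ => (hd d).const_mul _]
  simp only [deriv_const_mul_field]

lemma differentiableAt_timeCoeff {t : ℝ}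
    (he : ∀ (φ : Module.Dual ℝ 𝔤) (a : Fin 3), ContDiffOn ℝ 2 (fun t => φ (e t a)) (Set.Ioi t₀))
    (ht : t₀ < t) (a b : Fin 3) : DifferentiableAt ℝ (fun s => timeCoeff e s a b) t := by
  have hd : ∀ d, DifferentiableAt ℝ (deriv (fun s => (e t).coord d (e s b))) t := fun d =>
    (((he ((e t).coord d) b).deriv_of_isOpen isOpen_Ioi (m := 1) (by norm_num)).differentiableOn
      (by norm_num)).differentiableAt (Ioi_mem_nhds ht)
  have hw : ∀ d, DifferentiableAt ℝ (fun s => (e s).coord a (e t d)) t := fun d =>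
    ((contDiffOn_dual_frame he a (e t d)).differentiableOn (by norm_num)).differentiableAt
      (Ioi_mem_nhds ht)
  have h : DifferentiableAt ℝ (fun s => ∑ d,
      (e s).coord a (e t d) * deriv (fun s => (e t).coord d (e s b)) s) t :=
    DifferentiableAt.fun_sum fun d _ => (hw d).mul (hd d)
  refine h.congr_of_eventuallyEq ?_
  filter_upwards [Ioi_mem_nhds ht] with s hs
  exact timeCoeff_eq_sum he hs (e t) a b

lemma differentiableAt_expansion {t : ℝ}
    (he : ∀ (φ : Module.Dual ℝ 𝔤) (a : Fin 3), ContDiffOn ℝ 2 (fun t => φ (e t a)) (Set.Ioi t₀))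
    (ht : t₀ < t) (a b : Fin 3) : DifferentiableAt ℝ (fun s => expansion e s a b) t :=
  ((differentiableAt_timeCoeff he ht a b).add
    (differentiableAt_timeCoeff he ht b a)).neg.div_const 2

lemma differentiableAt_hubble {t : ℝ}
    (he : ∀ (φ : Module.Dual ℝ 𝔤) (a : Fin 3), ContDiffOn ℝ 2 (fun t => φ (e t a)) (Set.Ioi t₀))
    (ht : t₀ < t) : DifferentiableAt ℝ (hubble e) t := by
  rw [show hubble e = fun s => (∑ a, expansion e s a a) / 3 from funext (hubble_eq e)]
  exact (DifferentiableAt.fun_sum fun a _ => differentiableAt_expansion he ht a a).div_const 3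

/-- The Jacobi identity for `e₀, e_b, e_c`. -/
lemma hasDerivAt_spaceCoeff {t : ℝ}
    (he : ∀ (φ : Module.Dual ℝ 𝔤) (a : Fin 3), ContDiffOn ℝ 2 (fun t => φ (e t a)) (Set.Ioi t₀))
    (ht : t₀ < t) (a b c : Fin 3) :
    HasDerivAt (fun s => spaceCoeff e s a b c)
      (∑ d, (-(timeCoeff e t a d * spaceCoeff e t d b c) + timeCoeff e t d b * spaceCoeff e t a d c
        + timeCoeff e t d c * spaceCoeff e t a b d)) t := by
  set B := e t with hB
  have hM : ∀ d b, HasDerivAt (fun s => B.coord d (e s b)) (timeCoeff e t d b) t := fun d b =>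
    (((he (B.coord d) b).differentiableOn (by norm_num)).differentiableAt
      (Ioi_mem_nhds ht)).hasDerivAt
  have hW : ∀ d, HasDerivAt (fun s => (e s).coord a (B d)) (-timeCoeff e t a d) t := by
    intro d
    have h0 : ∀ d, HasDerivAt (fun s => (e s).coord a (B d))
        (deriv (fun s => (e s).coord a (B d)) t) t := fun d =>
      (((contDiffOn_dual_frame he a (B d)).differentiableOn (by norm_num)).differentiableAt
        (Ioi_mem_nhds ht)).hasDerivAt
    have h1 : HasDerivAt (fun s => ∑ f, (e s).coord a (B f) * B.coord f (e s d)) _ t :=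
      HasDerivAt.fun_sum fun f _ => (h0 f).mul (hM f d)
    simp only [frame_coord_mul] at h1
    have h2 := h1.unique (hasDerivAt_const t _)
    have h3 : ∀ f, B.coord f (e t d) = if f = d then 1 else 0 := by
      intro f
      simp [hB, Finsupp.single_apply, eq_comm]
    have h4 : ∀ f, (e t).coord a (B f) = if f = a then 1 else 0 := by
      intro f
      simp [hB, Finsupp.single_apply]
    simp only [h3, h4, Finset.sum_add_distrib] at h2
    simp at h2
    have := h0 d
    rwa [show deriv (fun s => (e s).coord a (B d)) t = -timeCoeff e t a d by
      simp only [Module.Basis.coord_apply]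
      linarith] at this
  have hexp : ∀ s, spaceCoeff e s a b c = ∑ f, ∑ p, ∑ r, (e s).coord a (B f) *
      (B.coord p (e s b) * B.coord r (e s c)) * spaceCoeff e t f p r := by
    intro s
    rw [spaceCoeff, coord_eq_sum B (e s)]
    refine Finset.sum_congr rfl fun f _ => ?_
    have hbr : B.coord f ⁅e s b, e s c⁆ = ∑ p, ∑ r,
        B.coord p (e s b) * B.coord r (e s c) * spaceCoeff e t f p r := by
      conv_lhs => rw [← B.sum_repr (e s b), ← B.sum_repr (e s c)]
      simp only [sum_lie, lie_sum, smul_lie, lie_smul, map_sum, map_smul, smul_eq_mul,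
        spaceCoeff, Module.Basis.coord_apply, ← hB, mul_assoc, Finset.mul_sum]
      rw [Finset.sum_comm]
      refine Finset.sum_congr rfl fun p _ => Finset.sum_congr rfl fun r _ => ?_
      ring
    rw [hbr]
    simp only [Finset.mul_sum, mul_assoc]
  have hder := HasDerivAt.fun_sum (u := Finset.univ) fun f _ =>
    HasDerivAt.fun_sum (u := Finset.univ) fun p _ =>
      HasDerivAt.fun_sum (u := Finset.univ) fun r _ =>
      ((hW f).mul ((hM p b).mul (hM r c))).mul_const (spaceCoeff e t f p r)
  simp only [fun s => hexp s]
  refine hder.congr_deriv ?_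
  have h3 : ∀ f d, B.coord f (e t d) = if f = d then 1 else 0 := by
    intro f d
    simp [hB, Finsupp.single_apply, eq_comm]
  have h4 : ∀ f, (e t).coord a (B f) = if f = a then 1 else 0 := by
    intro f
    simp [hB, Finsupp.single_apply]
  simp only [h3, h4, Pi.mul_apply]
  simp [Finset.sum_add_distrib, add_mul, mul_add]
  ring

end Smoothness

section StructureConstants

/-- The structure constants `c^a_{bd} = ε_{bdf} n^{fa} + δ^a_d a_b - δ^a_b a_d`, where `n` is
symmetric with rows `(p, u, v)`, `(u, q, w)`, `(v, w, r)`, and the covector `a` is `(x, y, z)`. -/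
def behr (p q r u v w x y z : ℝ) : Fin 3 → Fin 3 → Fin 3 → ℝ :=
  ![![![0, v - y, -(u + z)], ![-(v - y), 0, p], ![u + z, -p, 0]],
    ![![0, w + x, -q], ![-(w + x), 0, u - z], ![q, -(u - z), 0]],
    ![![0, r, -(w - x)], ![-r, 0, v + y], ![w - x, -(v + y), 0]]]

lemma exists_eq_behr {c : Fin 3 → Fin 3 → Fin 3 → ℝ} (hc : ∀ a b d, c a b d = -c a d b) :
    ∃ p q r u v w x y z : ℝ, c = behr p q r u v w x y z := by
  refine ⟨c 0 1 2, c 1 2 0, c 2 0 1, (c 1 1 2 + c 0 2 0) / 2, (c 2 1 2 + c 0 0 1) / 2,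
    (c 2 2 0 + c 1 0 1) / 2, (c 1 0 1 - c 2 2 0) / 2, (c 2 1 2 - c 0 0 1) / 2,
    (c 0 2 0 - c 1 1 2) / 2, ?_⟩
  have h0 : ∀ a b, c a b b = 0 := fun a b => by linarith [hc a b b]
  have h1 : ∀ a, c a 1 0 = -c a 0 1 := fun a => hc a 1 0
  have h2 : ∀ a, c a 2 1 = -c a 1 2 := fun a => hc a 2 1
  have h3 : ∀ a, c a 0 2 = -c a 2 0 := fun a => hc a 0 2
  funext a b d
  fin_cases a <;> fin_cases b <;> fin_cases d <;> simp [behr, h0, h1, h2, h3] <;> ring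

lemma spatialScalar_behr (p q r u v w x y z : ℝ) :
    spatialScalar (behr p q r u v w x y z) =
      -(6 * (x ^ 2 + y ^ 2 + z ^ 2) + (p ^ 2 + q ^ 2 + r ^ 2 + 2 * (u ^ 2 + v ^ 2 + w ^ 2))
        - (p + q + r) ^ 2 / 2) := by
  simp [spatialScalar, spatialRiemann, spatialConn, behr, Fin.sum_univ_three]
  ring

/-- The identity `|2 n² - (tr n) n|² = (2 tr (n²) - (tr n)²) tr (n²) + 4 (tr n) (det n)` for a
symmetric matrix `n`. -/
lemma sum_sq_two_mul_sq_sub (p q r u v w : ℝ) :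
    (2 * (p ^ 2 + u ^ 2 + v ^ 2) - (p + q + r) * p) ^ 2
      + (2 * (u ^ 2 + q ^ 2 + w ^ 2) - (p + q + r) * q) ^ 2
      + (2 * (v ^ 2 + w ^ 2 + r ^ 2) - (p + q + r) * r) ^ 2
      + 2 * ((2 * (p * u + u * q + v * w) - (p + q + r) * u) ^ 2
      + (2 * (p * v + u * w + v * r) - (p + q + r) * v) ^ 2
      + (2 * (u * v + q * w + w * r) - (p + q + r) * w) ^ 2) =
    (2 * (p ^ 2 + q ^ 2 + r ^ 2 + 2 * (u ^ 2 + v ^ 2 + w ^ 2)) - (p + q + r) ^ 2)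
      * (p ^ 2 + q ^ 2 + r ^ 2 + 2 * (u ^ 2 + v ^ 2 + w ^ 2))
      + 4 * (p + q + r) * (p * q * r + 2 * u * v * w - p * w ^ 2 - q * v ^ 2 - r * u ^ 2) := by
  ring

lemma sq_trace_le_of_det_eq_zero {p q r u v w : ℝ}
    (hdet : p * q * r + 2 * u * v * w - p * w ^ 2 - q * v ^ 2 - r * u ^ 2 = 0) :
    (p + q + r) ^ 2 ≤ 2 * (p ^ 2 + q ^ 2 + r ^ 2 + 2 * (u ^ 2 + v ^ 2 + w ^ 2)) := by
  have h := sum_sq_two_mul_sq_sub p q r u v w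
  rw [hdet, mul_zero, add_zero] at h
  set S := p ^ 2 + q ^ 2 + r ^ 2 + 2 * (u ^ 2 + v ^ 2 + w ^ 2) with hS
  have h1 : 0 ≤ (2 * S - (p + q + r) ^ 2) * S := by rw [← h]; positivity
  have hS0 : 0 ≤ S := by positivity
  rcases hS0.eq_or_lt with h0 | h0
  · have hp : p ^ 2 = 0 := by
      linarith [sq_nonneg p, sq_nonneg q, sq_nonneg r, sq_nonneg u, sq_nonneg v, sq_nonneg w]
    have hq : q ^ 2 = 0 := by
      linarith [sq_nonneg p, sq_nonneg q, sq_nonneg r, sq_nonneg u, sq_nonneg v, sq_nonneg w]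
    have hr : r ^ 2 = 0 := by
      linarith [sq_nonneg p, sq_nonneg q, sq_nonneg r, sq_nonneg u, sq_nonneg v, sq_nonneg w]
    rw [sq_eq_zero_iff] at hp hq hr
    rw [hp, hq, hr]
    simpa using hS0
  · have := nonneg_of_mul_nonneg_left h1 h0
    linarith

set_option maxHeartbeats 4000000 in
/-- In dimension three the Riemann tensor is determined by the Ricci tensor. -/
lemma spatialRiemann_behr_zero (p q r u v w : ℝ) (a b i j : Fin 3) (S : Fin 3 → Fin 3 → ℝ)
    (hS : S = ![![2 * (p ^ 2 + u ^ 2 + v ^ 2) - (p + q + r) * p,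
        2 * (p * u + u * q + v * w) - (p + q + r) * u,
        2 * (p * v + u * w + v * r) - (p + q + r) * v],
      ![2 * (p * u + u * q + v * w) - (p + q + r) * u,
        2 * (u ^ 2 + q ^ 2 + w ^ 2) - (p + q + r) * q,
        2 * (u * v + q * w + w * r) - (p + q + r) * w],
      ![2 * (p * v + u * w + v * r) - (p + q + r) * v,
        2 * (u * v + q * w + w * r) - (p + q + r) * w,
        2 * (v ^ 2 + w ^ 2 + r ^ 2) - (p + q + r) * r]]) :
    spatialRiemann (behr p q r u v w 0 0 0) a b i j =
      (if a = i then S b j else 0) - (if a = j then S b i else 0)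
      + (if b = j then S a i else 0) - (if b = i then S a j else 0)
      - 3 / 2 * (p ^ 2 + q ^ 2 + r ^ 2 + 2 * (u ^ 2 + v ^ 2 + w ^ 2) - (p + q + r) ^ 2 / 2) *
        ((if a = i ∧ b = j then 1 else 0) - (if a = j ∧ b = i then 1 else 0)) := by
  fin_cases a <;> fin_cases b <;> fin_cases i <;> fin_cases j <;>
    simp [spatialRiemann, spatialConn, behr, Fin.sum_univ_three, hS] <;> ring

/-- The structure constants of a three-dimensional Lie algebra that is not perfect. -/
structure IsNonperfect (c : Fin 3 → Fin 3 → Fin 3 → ℝ) : Prop where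
  antisymm : ∀ a b d, c a b d = -c a d b
  jacobi : ∀ f, ∑ d, (c d 1 2 * c f 0 d + c d 2 0 * c f 1 d + c d 0 1 * c f 2 d) = 0
  det_eq_zero : Matrix.det !![c 0 1 2, c 1 1 2, c 2 1 2; c 0 2 0, c 1 2 0, c 2 2 0;
    c 0 0 1, c 1 0 1, c 2 0 1] = 0

lemma IsNonperfect.exists_eq_behr {c : Fin 3 → Fin 3 → Fin 3 → ℝ} (hc : IsNonperfect c) :
    ∃ p q r u v w x y z : ℝ, c = behr p q r u v w x y z ∧
      p * q * r + 2 * u * v * w - p * w ^ 2 - q * v ^ 2 - r * u ^ 2 = 0 := by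
  obtain ⟨p, q, r, u, v, w, x, y, z, rfl⟩ := Bianchi.exists_eq_behr hc.antisymm
  refine ⟨p, q, r, u, v, w, x, y, z, rfl, ?_⟩
  have h0 := hc.jacobi 0
  have h1 := hc.jacobi 1
  have h2 := hc.jacobi 2
  have hd := hc.det_eq_zero
  simp [behr, Fin.sum_univ_three, Matrix.det_fin_three] at h0 h1 h2 hd
  linear_combination hd + x / 2 * h0 + y / 2 * h1 + z / 2 * h2

/-- The curvature of a left-invariant metric on a three-dimensional solvable Lie group is
nonpositive. -/
lemma IsNonperfect.spatialScalar_nonpos {c : Fin 3 → Fin 3 → Fin 3 → ℝ} (hc : IsNonperfect c) :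
    spatialScalar c ≤ 0 := by
  obtain ⟨p, q, r, u, v, w, x, y, z, rfl, hdet⟩ := hc.exists_eq_behr
  rw [spatialScalar_behr]
  have := sq_trace_le_of_det_eq_zero hdet
  linarith [sq_nonneg x, sq_nonneg y, sq_nonneg z]

lemma IsNonperfect.spatialRiemann_eq_zero {c : Fin 3 → Fin 3 → Fin 3 → ℝ} (hc : IsNonperfect c)
    (h : spatialScalar c = 0) (a b i j : Fin 3) : spatialRiemann c a b i j = 0 := by
  obtain ⟨p, q, r, u, v, w, x, y, z, rfl, hdet⟩ := hc.exists_eq_behr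
  rw [spatialScalar_behr] at h
  have h1 := sq_trace_le_of_det_eq_zero hdet
  have hx : x ^ 2 = 0 := by linarith [sq_nonneg x, sq_nonneg y, sq_nonneg z]
  have hy : y ^ 2 = 0 := by linarith [sq_nonneg x, sq_nonneg y, sq_nonneg z]
  have hz : z ^ 2 = 0 := by linarith [sq_nonneg x, sq_nonneg y, sq_nonneg z]
  have h2 : p ^ 2 + q ^ 2 + r ^ 2 + 2 * (u ^ 2 + v ^ 2 + w ^ 2) - (p + q + r) ^ 2 / 2 = 0 := by
    linarith
  have h3 := sum_sq_two_mul_sq_sub p q r u v w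
  rw [hdet, show 2 * (p ^ 2 + q ^ 2 + r ^ 2 + 2 * (u ^ 2 + v ^ 2 + w ^ 2)) - (p + q + r) ^ 2 = 0 by
    linarith, zero_mul, mul_zero, add_zero] at h3
  rw [sq_eq_zero_iff] at hx hy hz
  subst hx hy hz
  rw [spatialRiemann_behr_zero p q r u v w a b i j _ rfl, h2]
  set E₁ := 2 * (p ^ 2 + u ^ 2 + v ^ 2) - (p + q + r) * p
  set E₂ := 2 * (u ^ 2 + q ^ 2 + w ^ 2) - (p + q + r) * q
  set E₃ := 2 * (v ^ 2 + w ^ 2 + r ^ 2) - (p + q + r) * r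
  set E₄ := 2 * (p * u + u * q + v * w) - (p + q + r) * u
  set E₅ := 2 * (p * v + u * w + v * r) - (p + q + r) * v
  set E₆ := 2 * (u * v + q * w + w * r) - (p + q + r) * w
  have hE : E₁ ^ 2 = 0 ∧ E₂ ^ 2 = 0 ∧ E₃ ^ 2 = 0 ∧ E₄ ^ 2 = 0 ∧ E₅ ^ 2 = 0 ∧ E₆ ^ 2 = 0 := by
    refine ⟨?_, ?_, ?_, ?_, ?_, ?_⟩ <;>
    linarith [sq_nonneg E₁, sq_nonneg E₂, sq_nonneg E₃, sq_nonneg E₄, sq_nonneg E₅, sq_nonneg E₆]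
  simp only [sq_eq_zero_iff] at hE
  obtain ⟨k1, k2, k3, k4, k5, k6⟩ := hE
  have hS : (![![E₁, E₄, E₅], ![E₄, E₂, E₆], ![E₅, E₆, E₃]] : Fin 3 → Fin 3 → ℝ) = 0 := by
    rw [k1, k2, k3, k4, k5, k6]
    funext a b
    fin_cases a <;> fin_cases b <;> rfl
  rw [hS]
  simp

end StructureConstants

section Solvable

variable {𝔤 : Type*} [LieRing 𝔤] [LieAlgebra ℝ 𝔤]

lemma isNonperfect_of_isSolvable [LieAlgebra.IsSolvable 𝔤]
    (e : ℝ → Module.Basis (Fin 3) ℝ 𝔤) (t : ℝ) : IsNonperfect (spaceCoeff e t) where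
  antisymm := spaceCoeff_antisymm e t
  jacobi f := by
    have key : ∀ g a b, (e t).coord f ⁅e t g, ⁅e t a, e t b⁆⁆
        = ∑ d, spaceCoeff e t d a b * spaceCoeff e t f g d := by
      intro g a b
      conv_lhs => rw [← (e t).sum_repr ⁅e t a, e t b⁆]
      simp only [spaceCoeff, lie_sum, lie_smul, map_sum, map_smul, smul_eq_mul,
        Module.Basis.coord_apply]
    have h := congrArg ((e t).coord f) (lie_jacobi (e t 0) (e t 1) (e t 2))
    rw [map_add, map_add, key, key, key, map_zero] at h
    rw [Finset.sum_add_distrib, Finset.sum_add_distrib]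
    exact h
  det_eq_zero := by
    by_contra hdet
    set N : Matrix (Fin 3) (Fin 3) ℝ := !![spaceCoeff e t 0 1 2, spaceCoeff e t 1 1 2,
      spaceCoeff e t 2 1 2; spaceCoeff e t 0 2 0, spaceCoeff e t 1 2 0, spaceCoeff e t 2 2 0;
      spaceCoeff e t 0 0 1, spaceCoeff e t 1 0 1, spaceCoeff e t 2 0 1] with hN
    have : Nontrivial 𝔤 := (e t).repr.toEquiv.nontrivial
    have hlt := LieAlgebra.derivedSeries_lt_top_of_solvable ℝ 𝔤
    refine hlt.ne ?_
    rw [eq_top_iff]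
    set D := LieAlgebra.derivedSeries ℝ 𝔤 1 with hD
    have hmem : ∀ x y : 𝔤, ⁅x, y⁆ ∈ D := by
      intro x y
      rw [hD, LieAlgebra.derivedSeries_def, LieAlgebra.derivedSeriesOfIdeal_succ,
        LieAlgebra.derivedSeriesOfIdeal_zero]
      exact LieSubmodule.lie_mem_lie (LieSubmodule.mem_top x) (LieSubmodule.mem_top y)
    have hrow : ∀ d, ∑ a, N d a • e t a ∈ D := by
      have hbr : ∀ b c, ∑ a, spaceCoeff e t a b c • e t a = ⁅e t b, e t c⁆ := fun b c =>
        (e t).sum_repr _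
      intro d
      fin_cases d
      · convert hmem (e t 1) (e t 2) using 1
        rw [← hbr]; simp [Fin.sum_univ_three, hN]
      · convert hmem (e t 2) (e t 0) using 1
        rw [← hbr]; simp [Fin.sum_univ_three, hN]
      · convert hmem (e t 0) (e t 1) using 1
        rw [← hbr]; simp [Fin.sum_univ_three, hN]
    have hbasis : ∀ b, e t b ∈ D := by
      intro b
      have h1 : e t b = ∑ d, N⁻¹ b d • ∑ a, N d a • e t a := by
        simp only [Finset.smul_sum, smul_smul]
        rw [Finset.sum_comm]
        simp only [← Finset.sum_smul, ← Matrix.mul_apply]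
        rw [Matrix.nonsing_inv_mul _ (Ne.isUnit hdet)]
        simp [Matrix.one_apply]
      rw [h1]
      exact Submodule.sum_mem D.toSubmodule fun d _ => D.smul_mem _ (hrow d)
    intro x _
    rw [← (e t).sum_repr x]
    exact Submodule.sum_mem D.toSubmodule fun d _ => D.smul_mem _ (hbasis d)

end Solvable

section Evolution

variable {𝔤 : Type*} [LieRing 𝔤] [LieAlgebra ℝ 𝔤] {e : ℝ → Module.Basis (Fin 3) ℝ 𝔤} {t₀ t : ℝ}

lemma riemann_codazzi_shear (a i j : Fin 3) :
    riemann e t a.succ 0 i.succ j.succ =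
      ∑ l, (spatialConn (spaceCoeff e t) a i l * shear e t l j
        - spatialConn (spaceCoeff e t) a j l * shear e t l i
        - spaceCoeff e t l i j * shear e t a l) := by
  rw [riemann_codazzi]
  simp only [shear_eq, mul_sub, Finset.sum_sub_distrib]
  simp only [mul_ite, mul_zero, Finset.sum_ite_eq, Finset.sum_ite_eq', Finset.mem_univ, if_true]
  have h : spatialConn (spaceCoeff e t) a i j - spatialConn (spaceCoeff e t) a j i
      = spaceCoeff e t a i j := by
    simp only [spatialConn]
    rw [spaceCoeff_antisymm e t a j i]
    ring
  linear_combination hubble e t * h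

set_option maxHeartbeats 1000000 in
lemma riemann_mixed_eq
    (he : ∀ (φ : Module.Dual ℝ 𝔤) (a : Fin 3), ContDiffOn ℝ 2 (fun t => φ (e t a)) (Set.Ioi t₀))
    (ht : t₀ < t) (a b j : Fin 3) :
    riemann e t a.succ b.succ 0 j.succ = -riemann e t j.succ 0 a.succ b.succ := by
  have hd := fun a b c => hasDerivAt_spaceCoeff he ht a b c
  have hG := ((hd a j b).sub ((hd b j a).add (hd j b a))).div_const 2
  have hG' := hG.deriv
  rw [riemann_mixed, riemann_codazzi]
  simp only [spatialConn] at hG' ⊢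
  erw [hG']
  clear hG hG' hd
  obtain ⟨p, q, r, u, v, w, x, y, z, h⟩ := exists_eq_behr (spaceCoeff_antisymm e t)
  rw [h]
  fin_cases a <;> fin_cases b <;> fin_cases j <;>
    simp [behr, Fin.sum_univ_three, frameRotation, expansion] <;> ring

/-- The evolution of the norm of the structure constants, in which the rotation of the frame
cancels. -/
lemma hasDerivAt_sum_sq_spaceCoeff
    (he : ∀ (φ : Module.Dual ℝ 𝔤) (a : Fin 3), ContDiffOn ℝ 2 (fun t => φ (e t a)) (Set.Ioi t₀))
    (ht : t₀ < t) :
    HasDerivAt (fun s => ∑ a, ∑ b, ∑ c, spaceCoeff e s a b c ^ 2)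
      (-2 * hubble e t * ∑ a, ∑ b, ∑ c, spaceCoeff e t a b c ^ 2
      + ∑ a, ∑ b, ∑ c, ∑ d, 2 * (shear e t a d * spaceCoeff e t a b c * spaceCoeff e t d b c
        - shear e t d b * spaceCoeff e t a b c * spaceCoeff e t a d c
        - shear e t d c * spaceCoeff e t a b c * spaceCoeff e t a b d)) t := by
  have hd := HasDerivAt.fun_sum (u := Finset.univ) fun a _ =>
    HasDerivAt.fun_sum (u := Finset.univ) fun b _ =>
      HasDerivAt.fun_sum (u := Finset.univ) fun c _ =>
      (hasDerivAt_spaceCoeff he ht a b c).pow 2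
  refine hd.congr_deriv ?_
  obtain ⟨p, q, r, u, v, w, x, y, z, h⟩ := exists_eq_behr (spaceCoeff_antisymm e t)
  rw [h]
  simp [behr, Fin.sum_univ_three, shear_eq, hubble_eq, expansion]
  ring

lemma ricci_zero_zero_eq
    (he : ∀ (φ : Module.Dual ℝ 𝔤) (a : Fin 3), ContDiffOn ℝ 2 (fun t => φ (e t a)) (Set.Ioi t₀))
    (ht : t₀ < t) :
    ricci e t 0 0 = -3 * deriv (hubble e) t - ∑ a, ∑ b, expansion e t a b ^ 2 := by
  have hH : deriv (hubble e) t = (∑ a, deriv (fun s => expansion e s a a) t) / 3 := by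
    rw [show hubble e = fun s => (∑ a, expansion e s a a) / 3 from funext (hubble_eq e)]
    rw [deriv_div_const, deriv_fun_sum fun a _ => differentiableAt_expansion he ht a a]
  rw [ricci_zero_zero, hH]
  simp only [riemann_electric, Finset.sum_add_distrib, Finset.sum_neg_distrib]
  simp only [Fin.sum_univ_three, expansion, frameRotation]
  ring

lemma sum_sq_expansion :
    ∑ a, ∑ b, expansion e t a b ^ 2 = 3 * hubble e t ^ 2 + ∑ a, ∑ b, shear e t a b ^ 2 := by
  simp [shear_eq, Fin.sum_univ_three, hubble_eq]
  ring

end Evolution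

section Matter

lemma sum_fin_succ_fun {n : ℕ} (F : (Fin (n + 1) → Fin 4) → ℝ) :
    ∑ f, F f = ∑ a, ∑ g : Fin n → Fin 4, F (Fin.cons a g) := by
  rw [← (Fin.consEquiv (fun _ : Fin (n + 1) => Fin 4)).sum_comp, Fintype.sum_prod_type]
  rfl

lemma sum_fin_zero_fun (F : (Fin 0 → Fin 4) → ℝ) : ∑ f, F f = F ![] := by
  rw [Fintype.sum_unique]
  congr 1

lemma formT_one_form (P : ℝ → (Fin 1 → Fin 4) → ℝ) (t : ℝ) (μ ν : Fin 4) :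
    formT (q := 0) P t μ ν = P t ![μ] * P t ![ν]
      - eta μ ν / 2 * ∑ α, etaDiag α * P t ![α] ^ 2 := by
  simp only [formT, sum_fin_succ_fun, sum_fin_zero_fun]
  have h : ∀ α : Fin 4, (Fin.cons α ![] : Fin 1 → Fin 4) = ![α] := fun _ => rfl
  simp [h]
  left
  ring

lemma formT_three_form (P : ℝ → (Fin 3 → Fin 4) → ℝ) (t : ℝ)
    (hP : ∀ (m : Fin 3 → Fin 4) (s : Equiv.Perm (Fin 3)),
      P t (m ∘ s) = ((Equiv.Perm.sign s : ℤ) : ℝ) * P t m) (V : Fin 4 → ℝ)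
    (hV : V = ![P t ![1, 2, 3], P t ![0, 2, 3], -P t ![0, 1, 3], P t ![0, 1, 2]]) (μ ν : Fin 4) :
    formT (q := 2) P t μ ν = V μ * V ν - eta μ ν / 2 * ∑ α, etaDiag α * V α ^ 2 := by
  have h01 : ∀ a b c, P t ![a, b, c] = -P t ![b, a, c] := by
    intro a b c
    have h := hP ![b, a, c] (Equiv.swap 0 1)
    rw [Equiv.Perm.sign_swap (by decide)] at h
    rw [show (![b, a, c] : Fin 3 → Fin 4) ∘ (Equiv.swap (0 : Fin 3) 1) = ![a, b, c] by
      funext i; fin_cases i <;> rfl] at h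
    simpa using h
  have h12 : ∀ a b c, P t ![a, b, c] = -P t ![a, c, b] := by
    intro a b c
    have h := hP ![a, c, b] (Equiv.swap 1 2)
    rw [Equiv.Perm.sign_swap (by decide)] at h
    rw [show (![a, c, b] : Fin 3 → Fin 4) ∘ (Equiv.swap (1 : Fin 3) 2) = ![a, b, c] by
      funext i; fin_cases i <;> rfl] at h
    simpa using h
  have e1 : ∑ m : Fin 3 → Fin 4, (∏ i, etaDiag (m i)) * P t m ^ 2
      = ∑ a, ∑ b, ∑ c, etaDiag a * etaDiag b * etaDiag c * P t ![a, b, c] ^ 2 := by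
    simp only [sum_fin_succ_fun, sum_fin_zero_fun, Fin.prod_univ_three]
    rfl
  have e2 : ∑ n : Fin 2 → Fin 4,
      (∏ i, etaDiag (n i)) * (P t (Fin.cons μ n) * P t (Fin.cons ν n))
      = ∑ b, ∑ c, etaDiag b * etaDiag c * (P t ![μ, b, c] * P t ![ν, b, c]) := by
    simp only [sum_fin_succ_fun, sum_fin_zero_fun, Fin.prod_univ_two]
    rfl
  rw [formT, e1, e2]
  clear e1 e2
  set p : Fin 4 → Fin 4 → Fin 4 → ℝ := fun a b c => P t ![a, b, c] with hp
  have hpd : ∀ a b c, P t ![a, b, c] = p a b c := fun _ _ _ => rfl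
  simp only [hpd] at h01 h12 hV ⊢
  clear_value p
  have z1 : ∀ a b, p a a b = 0 := fun a b => by linarith [h01 a a b]
  have z2 : ∀ a b, p a b b = 0 := fun a b => by linarith [h12 a b b]
  have z3 : ∀ a b, p a b a = 0 := fun a b => by rw [h12, z1, neg_zero]
  have k1 : ∀ a, p a 1 0 = -p a 0 1 := fun a => h12 ..
  have k2 : ∀ a, p a 2 0 = -p a 0 2 := fun a => h12 ..
  have k3 : ∀ a, p a 3 0 = -p a 0 3 := fun a => h12 ..
  have k4 : ∀ a, p a 2 1 = -p a 1 2 := fun a => h12 ..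
  have k5 : ∀ a, p a 3 1 = -p a 1 3 := fun a => h12 ..
  have k6 : ∀ a, p a 3 2 = -p a 2 3 := fun a => h12 ..
  have l1 : p 1 0 2 = -p 0 1 2 := h01 ..
  have l2 : p 1 0 3 = -p 0 1 3 := h01 ..
  have l3 : p 2 0 3 = -p 0 2 3 := h01 ..
  have l4 : p 2 1 3 = -p 1 2 3 := h01 ..
  have l5 : p 2 0 1 = p 0 1 2 := by rw [h01, h12, neg_neg]
  have l6 : p 3 0 1 = p 0 1 3 := by rw [h01, h12, neg_neg]
  have l7 : p 3 0 2 = p 0 2 3 := by rw [h01, h12, neg_neg]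
  have l8 : p 3 1 2 = p 1 2 3 := by rw [h01, h12, neg_neg]
  have htr : ∑ a, ∑ b, ∑ c, etaDiag a * etaDiag b * etaDiag c * p a b c ^ 2
      = -6 * ∑ α, etaDiag α * V α ^ 2 := by
    simp [Fin.sum_univ_four, z1, z2, z3, k1, k2, k3, k4, k5, k6, l1, l2, l3, l4, l5, l6, l7, l8,
      hV, etaDiag]
    ring
  have hsum : ∑ b, ∑ c, etaDiag b * etaDiag c * (p μ b c * p ν b c)
      = 2 * (V μ * V ν) - 2 * eta μ ν * ∑ α, etaDiag α * V α ^ 2 := by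
    fin_cases μ <;> fin_cases ν <;>
    simp [Fin.sum_univ_four, z1, z2, z3, k1, k2, k3, k4, k5, k6, l1, l2, l3, l4, l5, l6, l7, l8,
      hV, etaDiag, eta] <;> ring
  rw [htr, hsum]
  simp [Nat.factorial]
  ring

/-- Energy conditions on the frame components of an energy-momentum tensor: the energy density
`T₀₀` is nonnegative, bounds all components, and a multiple of it is bounded by
`(3 T₀₀ + tr T) / 2`, where `tr` is the spatial trace. -/
structure IsDecaying (κ C : ℝ) (T : Fin 4 → Fin 4 → ℝ) : Prop where
  nonneg : 0 ≤ T 0 0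
  bound : ∀ μ ν, |T μ ν| ≤ C * T 0 0
  focus : κ * T 0 0 ≤ (3 * T 0 0 + ∑ a : Fin 3, T a.succ a.succ) / 2

lemma IsDecaying.add {κ κ' C C' : ℝ} {T T' : Fin 4 → Fin 4 → ℝ} (h : IsDecaying κ C T)
    (h' : IsDecaying κ' C' T') :
    IsDecaying (min κ κ') (max C C') (fun μ ν => T μ ν + T' μ ν) where
  nonneg := add_nonneg h.nonneg h'.nonneg
  bound μ ν := by
    have h1 := mul_le_mul_of_nonneg_right (le_max_left C C') h.nonneg
    have h2 := mul_le_mul_of_nonneg_right (le_max_right C C') h'.nonneg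
    have := abs_add_le (T μ ν) (T' μ ν)
    linarith [h.bound μ ν, h'.bound μ ν]
  focus := by
    have h1 := mul_le_mul_of_nonneg_right (min_le_left κ κ') h.nonneg
    have h2 := mul_le_mul_of_nonneg_right (min_le_right κ κ') h'.nonneg
    have h3 := h.focus
    have h4 := h'.focus
    rw [Finset.sum_add_distrib]
    linarith

lemma isDecaying_scalar (V : Fin 4 → ℝ) :
    IsDecaying 1 3 (fun μ ν => V μ * V ν - eta μ ν / 2 * ∑ α, etaDiag α * V α ^ 2) := by
  have h0 : V 0 * V 0 - eta 0 0 / 2 * ∑ α, etaDiag α * V α ^ 2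
      = (V 0 ^ 2 + V 1 ^ 2 + V 2 ^ 2 + V 3 ^ 2) / 2 := by
    simp [eta, Fin.sum_univ_four, etaDiag]
    ring
  have hV : ∀ μ, V μ ^ 2 ≤ V 0 ^ 2 + V 1 ^ 2 + V 2 ^ 2 + V 3 ^ 2 := by
    intro μ
    fin_cases μ <;> simp <;>
      linarith [sq_nonneg (V 0), sq_nonneg (V 1), sq_nonneg (V 2), sq_nonneg (V 3)]
  constructor
  · rw [h0]; positivity
  · intro μ ν
    rw [h0]
    have hs : |∑ α, etaDiag α * V α ^ 2| ≤ V 0 ^ 2 + V 1 ^ 2 + V 2 ^ 2 + V 3 ^ 2 := by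
      simp only [Fin.sum_univ_four, etaDiag]
      rw [abs_le]
      constructor <;> simp <;>
        linarith [sq_nonneg (V 0), sq_nonneg (V 1), sq_nonneg (V 2), sq_nonneg (V 3)]
    have he : |eta μ ν / 2| ≤ 1 / 2 := by
      unfold eta
      split_ifs
      · cases μ using Fin.cases <;> norm_num [abs_div]
      · simp
    have hm : |eta μ ν / 2 * ∑ α, etaDiag α * V α ^ 2|
        ≤ 1 / 2 * (V 0 ^ 2 + V 1 ^ 2 + V 2 ^ 2 + V 3 ^ 2) := by
      rw [abs_mul]
      exact mul_le_mul he hs (abs_nonneg _) (by norm_num)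
    have hv : |V μ * V ν| ≤ V 0 ^ 2 + V 1 ^ 2 + V 2 ^ 2 + V 3 ^ 2 := by
      rw [abs_le]
      constructor <;> nlinarith [hV μ, hV ν, sq_nonneg (V μ + V ν), sq_nonneg (V μ - V ν)]
    have := abs_sub (V μ * V ν) (eta μ ν / 2 * ∑ α, etaDiag α * V α ^ 2)
    linarith
  · rw [h0]
    simp [Fin.sum_univ_three, eta, Fin.sum_univ_four, etaDiag]
    nlinarith [sq_nonneg (V 0), sq_nonneg (V 1), sq_nonneg (V 2), sq_nonneg (V 3)]

lemma isDecaying_formT {q : ℕ} (hj : q + 1 = 1 ∨ q + 1 = 3) (P : ℝ → (Fin (q + 1) → Fin 4) → ℝ)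
    (t : ℝ) (hP : ∀ (m : Fin (q + 1) → Fin 4) (s : Equiv.Perm (Fin (q + 1))),
      P t (m ∘ s) = ((Equiv.Perm.sign s : ℤ) : ℝ) * P t m) : IsDecaying 1 3 (formT P t) := by
  rcases hj with h | h
  · obtain rfl : q = 0 := by omega
    have := isDecaying_scalar fun μ => P t ![μ]
    rwa [← show formT P t = _ from funext fun μ => funext fun ν => formT_one_form P t μ ν] at this
  · obtain rfl : q = 2 := by omega
    have := isDecaying_scalar ![P t ![1, 2, 3], P t ![0, 2, 3], -P t ![0, 1, 3], P t ![0, 1, 2]]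
    rwa [← show formT P t = _ from
      funext fun μ => funext fun ν => formT_three_form P t hP _ rfl μ ν] at this

lemma isDecaying_fluidT {γ : ℝ} (hγ : 0 < γ) {ρ : ℝ → ℝ} {U : ℝ → Fin 4 → ℝ} {t : ℝ}
    (hρ : 0 ≤ ρ t) (hU : ∑ μ, etaDiag μ * U t μ ^ 2 = -1) :
    IsDecaying (min 1 (3 * γ / 2)) (2 + 2 * γ) (fluidT γ ρ U t) := by
  have hU0 : U t 0 ^ 2 = 1 + (U t 1 ^ 2 + U t 2 ^ 2 + U t 3 ^ 2) := by
    simp [Fin.sum_univ_four, etaDiag] at hU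
    linarith
  set u := U t 1 ^ 2 + U t 2 ^ 2 + U t 3 ^ 2 with hu
  have hu0 : 0 ≤ u := by positivity
  have h0 : fluidT γ ρ U t 0 0 = ρ t * (1 + γ * u) := by
    simp [fluidT, eta]
    linear_combination γ * ρ t * hU0
  have hγu : 0 ≤ γ * u := by positivity
  constructor
  · rw [h0]; positivity
  · intro μ ν
    rw [h0]
    have hV : ∀ μ, (etaDiag μ * U t μ) ^ 2 ≤ 1 + u := by
      intro μ
      fin_cases μ <;> simp [etaDiag] <;>
        nlinarith [sq_nonneg (U t 1), sq_nonneg (U t 2), sq_nonneg (U t 3)]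
    have hv : |(etaDiag μ * U t μ) * (etaDiag ν * U t ν)| ≤ 1 + u := by
      rw [abs_le]
      constructor <;> nlinarith [hV μ, hV ν, sq_nonneg (etaDiag μ * U t μ + etaDiag ν * U t ν),
        sq_nonneg (etaDiag μ * U t μ - etaDiag ν * U t ν)]
    have he : |eta μ ν| ≤ 1 := by
      unfold eta
      split_ifs
      · cases μ using Fin.cases <;> simp
      · simp
    have h1 : |γ * ρ t * ((etaDiag μ * U t μ) * (etaDiag ν * U t ν))| ≤ γ * ρ t * (1 + u) := by
      rw [abs_mul, abs_of_nonneg (by positivity : 0 ≤ γ * ρ t)]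
      exact mul_le_mul_of_nonneg_left hv (by positivity)
    have h2 : |(γ - 1) * ρ t * eta μ ν| ≤ (γ + 1) * ρ t := by
      rw [abs_mul, abs_mul, abs_of_nonneg hρ]
      have : |γ - 1| ≤ γ + 1 := by rw [abs_le]; constructor <;> linarith
      calc |γ - 1| * ρ t * |eta μ ν| ≤ |γ - 1| * ρ t * 1 :=
            mul_le_mul_of_nonneg_left he (by positivity)
        _ ≤ (γ + 1) * ρ t := by
            rw [mul_one]; exact mul_le_mul_of_nonneg_right this hρ
    have h3 := abs_add_le (γ * ρ t * ((etaDiag μ * U t μ) * (etaDiag ν * U t ν)))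
      ((γ - 1) * ρ t * eta μ ν)
    have h4 : γ * ρ t * (1 + u) + (γ + 1) * ρ t ≤ (2 + 2 * γ) * (ρ t * (1 + γ * u)) := by
      have h5 : 0 ≤ ρ t * (γ * u) := by positivity
      have h6 : 0 ≤ γ * (ρ t * (γ * u)) := by positivity
      nlinarith
    exact h3.trans ((add_le_add h1 h2).trans h4)
  · have htr : ∑ a : Fin 3, fluidT γ ρ U t a.succ a.succ = ρ t * (γ * u + 3 * (γ - 1)) := by
      simp [fluidT, eta, Fin.sum_univ_three, hu]
      ring
    rw [htr, h0]
    have h1 := min_le_left (1 : ℝ) (3 * γ / 2)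
    have h2 := min_le_right (1 : ℝ) (3 * γ / 2)
    have h3 : 0 ≤ ρ t * (γ * u) := by positivity
    nlinarith [mul_le_mul_of_nonneg_right h2 hρ, mul_le_mul_of_nonneg_right h1 h3]

lemma fluidT_zero (ρ : ℝ → ℝ) (U : ℝ → Fin 4 → ℝ) (t : ℝ) (μ ν : Fin 4) :
    fluidT 0 ρ U t μ ν = -(ρ t * eta μ ν) := by
  simp [fluidT]

/-- A fluid with `γ = 0` has constant energy density. -/
lemma deriv_density_eq_zero {𝔤 : Type*} [LieRing 𝔤] [LieAlgebra ℝ 𝔤]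
    {e : ℝ → Module.Basis (Fin 3) ℝ 𝔤} {ρ : ℝ → ℝ} {U : ℝ → Fin 4 → ℝ} {t : ℝ}
    (h : divergence e (n := 1) (fun s i => fluidT 0 ρ U s (i 0) (i 1)) t ![0] = 0) :
    deriv ρ t = 0 := by
  simp only [divergence, covDeriv, fluidT_zero] at h
  rw [Fin.sum_univ_succ] at h
  simp [Fin.sum_univ_succ (n := 3), Fin.sum_univ_two, eta] at h
  exact h

end Matter

section Analysis

lemma tendsto_zero_of_deriv_le {f f' : ℝ → ℝ} {t₁ κ : ℝ} (hκ : 0 < κ)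
    (hf : ∀ t > t₁, HasDerivAt f (f' t) t) (hle : ∀ t > t₁, f' t ≤ -κ * f t)
    (h0 : ∀ t > t₁, 0 ≤ f t) : Tendsto f atTop (𝓝 0) := by
  have hg : ∀ t > t₁, HasDerivAt (fun t => f t * Real.exp (κ * t))
      (f' t * Real.exp (κ * t) + f t * (Real.exp (κ * t) * (κ * 1))) t := fun t ht =>
    (hf t ht).mul (((hasDerivAt_id t).const_mul κ).exp)
  have hanti : AntitoneOn (fun t => f t * Real.exp (κ * t)) (Set.Ici (t₁ + 1)) := by
    refine antitoneOn_of_deriv_nonpos (convex_Ici _) ?_ ?_ ?_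
    · intro t ht
      exact (hg t (by have := Set.mem_Ici.1 ht; linarith)).continuousAt.continuousWithinAt
    · intro t ht
      rw [interior_Ici] at ht
      exact (hg t (by have := Set.mem_Ioi.1 ht; linarith)).differentiableAt.differentiableWithinAt
    · intro t ht
      rw [interior_Ici] at ht
      have ht' : t > t₁ := by have := Set.mem_Ioi.1 ht; linarith
      rw [(hg t ht').deriv]
      have := hle t ht'
      have hE := Real.exp_pos (κ * t)
      nlinarith
  set A := f (t₁ + 1) * Real.exp (κ * (t₁ + 1))
  have hlim : Tendsto (fun t => A * Real.exp (-(κ * t))) atTop (𝓝 0) := by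
    have h1 : Tendsto (fun t : ℝ => κ * t) atTop atTop := tendsto_id.const_mul_atTop hκ
    simpa using (Real.tendsto_exp_neg_atTop_nhds_zero.comp h1).const_mul A
  refine tendsto_of_tendsto_of_tendsto_of_le_of_le' tendsto_const_nhds hlim ?_ ?_
  · filter_upwards [eventually_gt_atTop t₁] with t ht using h0 t ht
  · filter_upwards [eventually_ge_atTop (t₁ + 1)] with t ht
    have h1 : f t * Real.exp (κ * t) ≤ A := hanti Set.self_mem_Ici (Set.mem_Ici.2 ht) ht
    rw [Real.exp_neg, ← div_eq_mul_inv, le_div_iff₀ (Real.exp_pos _)]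
    exact h1

lemma not_forall_sq_le_deriv {f f' : ℝ → ℝ} {t₁ κ : ℝ} (hκ : 0 < κ)
    (hf : ∀ t > t₁, HasDerivAt f (f' t) t) (h0 : ∀ t > t₁, 0 < f t)
    (hle : ∀ t > t₁, κ * f t ^ 2 ≤ f' t) : False := by
  have hg : ∀ t > t₁, HasDerivAt (fun t => (f t)⁻¹ + κ * t) (-f' t / f t ^ 2 + κ * 1) t :=
    fun t ht => ((hf t ht).fun_inv (h0 t ht).ne').add ((hasDerivAt_id t).const_mul κ)
  have hanti : AntitoneOn (fun t => (f t)⁻¹ + κ * t) (Set.Ici (t₁ + 1)) := by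
    refine antitoneOn_of_deriv_nonpos (convex_Ici _) ?_ ?_ ?_
    · intro t ht
      exact (hg t (by have := Set.mem_Ici.1 ht; linarith)).continuousAt.continuousWithinAt
    · intro t ht
      rw [interior_Ici] at ht
      exact (hg t (by have := Set.mem_Ioi.1 ht; linarith)).differentiableAt.differentiableWithinAt
    · intro t ht
      rw [interior_Ici] at ht
      have ht' : t > t₁ := by have := Set.mem_Ioi.1 ht; linarith
      rw [(hg t ht').deriv]
      have h1 : κ ≤ f' t / f t ^ 2 := (le_div_iff₀ (pow_pos (h0 t ht') 2)).2 (hle t ht')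
      rw [neg_div]
      linarith
  have hpos : 0 < (f (t₁ + 1))⁻¹ := inv_pos.2 (h0 _ (by linarith))
  set s := t₁ + 1 + (f (t₁ + 1))⁻¹ / κ with hs
  have hs1 : t₁ + 1 ≤ s := by
    have : 0 < (f (t₁ + 1))⁻¹ / κ := div_pos hpos hκ
    linarith
  have h1 : (f s)⁻¹ + κ * s ≤ (f (t₁ + 1))⁻¹ + κ * (t₁ + 1) :=
    hanti Set.self_mem_Ici (Set.mem_Ici.2 hs1) hs1
  have h2 : κ * s = κ * (t₁ + 1) + (f (t₁ + 1))⁻¹ := by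
    rw [hs]; field_simp
  have h3 : 0 < (f s)⁻¹ := inv_pos.2 (h0 _ (by linarith))
  linarith

lemma tendsto_zero_of_sq_le {f g : ℝ → ℝ} (h : ∀ᶠ t in atTop, f t ^ 2 ≤ g t)
    (hg : Tendsto g atTop (𝓝 0)) : Tendsto f atTop (𝓝 0) := by
  have h2 : Tendsto (fun t => f t ^ 2) atTop (𝓝 0) :=
    tendsto_of_tendsto_of_tendsto_of_le_of_le' tendsto_const_nhds hg
      (Eventually.of_forall fun t => sq_nonneg _) h
  have h3 := h2.sqrt
  simp only [Real.sqrt_sq_eq_abs, Real.sqrt_zero] at h3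
  exact (tendsto_zero_iff_abs_tendsto_zero _).2 h3

end Analysis

section Asymptotics

variable {𝔤 : Type*} [LieRing 𝔤] [LieAlgebra ℝ 𝔤] {e : ℝ → Module.Basis (Fin 3) ℝ 𝔤}
  {t₀ Λ : ℝ} {T : ℝ → Fin 4 → Fin 4 → ℝ}

lemma friedmann {t : ℝ} (hE : einstein e t 0 0 = T t 0 0 - Λ * eta 0 0) :
    3 * hubble e t ^ 2 - Λ = (∑ a, ∑ b, shear e t a b ^ 2) / 2
      - spatialScalar (spaceCoeff e t) / 2 + T t 0 0 := by
  rw [einstein_zero_zero, sum_sq_expansion] at hE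
  simp [eta] at hE
  linarith

lemma raychaudhuri {t : ℝ}
    (he : ∀ (φ : Module.Dual ℝ 𝔤) (a : Fin 3), ContDiffOn ℝ 2 (fun t => φ (e t a)) (Set.Ioi t₀))
    (ht : t₀ < t) (hE : ∀ μ ν, einstein e t μ ν = T t μ ν - Λ * eta μ ν) :
    -3 * deriv (hubble e) t = 3 / 2 * (∑ a, ∑ b, shear e t a b ^ 2)
      - spatialScalar (spaceCoeff e t) / 2
      + (3 * T t 0 0 + ∑ a : Fin 3, T t a.succ a.succ) / 2 := by
  have h1 := friedmann (hE 0 0)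
  have h2 := ricci_zero_zero_of_einstein e t
  rw [ricci_zero_zero_eq he ht, sum_sq_expansion] at h2
  simp only [hE, Finset.sum_sub_distrib] at h2
  simp [eta] at h2
  linarith

lemma tendsto_riemann {h : ℝ}
    (he : ∀ (φ : Module.Dual ℝ 𝔤) (a : Fin 3), ContDiffOn ℝ 2 (fun t => φ (e t a)) (Set.Ioi t₀))
    (hE : ∀ t > t₀, ∀ μ ν, einstein e t μ ν = T t μ ν - Λ * eta μ ν)
    (hT : ∀ μ ν, Tendsto (fun t => T t μ ν) atTop (𝓝 0)) (hh : h ^ 2 = Λ / 3)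
    (hθ : ∀ a b, Tendsto (fun t => expansion e t a b) atTop (𝓝 (if a = b then h else 0)))
    (hR : ∀ a b i j, Tendsto (fun t => spatialRiemann (spaceCoeff e t) a b i j) atTop (𝓝 0))
    (hcσ : ∀ a b c i j, Tendsto (fun t => spaceCoeff e t a b c * shear e t i j) atTop (𝓝 0))
    (ρ σ μ ν : Fin 4) :
    Tendsto (fun t => etaDiag ρ * riemann e t ρ σ μ ν) atTop
      (𝓝 (Λ / 3 * (eta ρ μ * eta σ ν - eta ρ ν * eta σ μ))) := by
  have swapL : ∀ {ρ σ μ ν}, Tendsto (fun t => etaDiag ρ * riemann e t ρ σ μ ν) atTop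
      (𝓝 (Λ / 3 * (eta ρ μ * eta σ ν - eta ρ ν * eta σ μ))) →
      Tendsto (fun t => etaDiag σ * riemann e t σ ρ μ ν) atTop
      (𝓝 (Λ / 3 * (eta σ μ * eta ρ ν - eta σ ν * eta ρ μ))) := by
    intro ρ σ μ ν h
    simp only [fun t => riemann_antisymm_left e t σ ρ μ ν]
    convert h.neg using 2
    ring
  have swapR : ∀ {ρ σ μ ν}, Tendsto (fun t => etaDiag ρ * riemann e t ρ σ μ ν) atTop
      (𝓝 (Λ / 3 * (eta ρ μ * eta σ ν - eta ρ ν * eta σ μ))) →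
      Tendsto (fun t => etaDiag ρ * riemann e t ρ σ ν μ) atTop
      (𝓝 (Λ / 3 * (eta ρ ν * eta σ μ - eta ρ μ * eta σ ν))) := by
    intro ρ σ μ ν h
    simp only [fun t => riemann_antisymm_right e t ρ σ ν μ, mul_neg]
    convert h.neg using 2
    ring
  have selfL : ∀ ρ μ ν, Tendsto (fun t => etaDiag ρ * riemann e t ρ ρ μ ν) atTop
      (𝓝 (Λ / 3 * (eta ρ μ * eta ρ ν - eta ρ ν * eta ρ μ))) := by
    intro ρ μ ν
    simp only [riemann_self_left, mul_comm (eta ρ ν), sub_self, mul_zero]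
    exact tendsto_const_nhds
  have selfR : ∀ ρ σ μ, Tendsto (fun t => etaDiag ρ * riemann e t ρ σ μ μ) atTop
      (𝓝 (Λ / 3 * (eta ρ μ * eta σ μ - eta ρ μ * eta σ μ))) := by
    intro ρ σ μ
    simp only [riemann_self_right, sub_self, mul_zero]
    exact tendsto_const_nhds
  have eta0s : ∀ a : Fin 3, eta 0 a.succ = 0 := fun a => by simp [eta, (Fin.succ_ne_zero a).symm]
  have etas0 : ∀ a : Fin 3, eta a.succ 0 = 0 := fun a => by simp [eta, Fin.succ_ne_zero a]
  have etass : ∀ a b : Fin 3, eta a.succ b.succ = if a = b then 1 else 0 := fun a b => by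
    simp [eta]
  have gauss' : ∀ a b i j : Fin 3, Tendsto (fun t => riemann e t a.succ b.succ i.succ j.succ) atTop
      (𝓝 (Λ / 3 * ((if a = i then 1 else 0) * (if b = j then 1 else 0)
        - (if a = j then 1 else 0) * (if b = i then 1 else 0)))) := by
    intro a b i j
    simp only [riemann_spatial]
    convert (hR a b i j).add (((hθ a i).mul (hθ j b)).sub ((hθ a j).mul (hθ i b))) using 2
    rw [← hh]
    simp only [eq_comm (a := j) (b := b), eq_comm (a := i) (b := b)]
    split_ifs <;> ring
  have gauss : ∀ a b i j : Fin 3, Tendsto (fun t => etaDiag a.succ *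
      riemann e t a.succ b.succ i.succ j.succ) atTop (𝓝 (Λ / 3 * (eta a.succ i.succ *
      eta b.succ j.succ - eta a.succ j.succ * eta b.succ i.succ))) := by
    intro a b i j
    simpa only [etass, etaDiag_succ, one_mul] using gauss' a b i j
  have codazzi' : ∀ a i j : Fin 3, Tendsto (fun t => riemann e t a.succ 0 i.succ j.succ)
      atTop (𝓝 0) := by
    intro a i j
    have hG : ∀ a b c i j, Tendsto (fun t => spatialConn (spaceCoeff e t) a b c * shear e t i j)
        atTop (𝓝 0) := by
      intro a b c i j
      have := ((hcσ a b c i j).sub ((hcσ c b a i j).add (hcσ b c a i j))).div_const 2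
      simp only [add_zero, sub_zero, zero_div] at this
      refine this.congr fun t => ?_
      simp only [spatialConn]
      ring
    simp only [riemann_codazzi_shear]
    rw [show (0 : ℝ) = ∑ l : Fin 3, (0 - 0 - 0) by simp]
    exact tendsto_finsetSum _ fun l _ =>
      ((hG a i l l j).sub (hG a j l l i)).sub (hcσ l i j a l)
  have codazzi : ∀ a i j : Fin 3, Tendsto (fun t => etaDiag a.succ *
      riemann e t a.succ 0 i.succ j.succ) atTop (𝓝 (Λ / 3 * (eta a.succ i.succ *
      eta 0 j.succ - eta a.succ j.succ * eta 0 i.succ))) := by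
    intro a i j
    simpa only [eta0s, etaDiag_succ, one_mul, mul_zero, sub_zero] using codazzi' a i j
  have mixed : ∀ a b j : Fin 3, Tendsto (fun t => etaDiag a.succ *
      riemann e t a.succ b.succ 0 j.succ) atTop (𝓝 (Λ / 3 * (eta a.succ 0 *
      eta b.succ j.succ - eta a.succ j.succ * eta b.succ 0))) := by
    intro a b j
    simp only [etas0, etaDiag_succ, one_mul, mul_zero, zero_mul, sub_zero]
    have := (codazzi' j a b).neg
    rw [neg_zero] at this
    refine this.congr' ?_
    filter_upwards [eventually_gt_atTop t₀] with t ht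
    rw [riemann_mixed_eq he ht]
  have electric : ∀ a b : Fin 3, Tendsto (fun t => etaDiag a.succ *
      riemann e t a.succ 0 b.succ 0) atTop (𝓝 (Λ / 3 * (eta a.succ b.succ *
      eta 0 0 - eta a.succ 0 * eta 0 b.succ))) := by
    intro a b
    have hEl : ∀ μ ν, Tendsto (fun t => einstein e t μ ν) atTop (𝓝 (0 - Λ * eta μ ν)) := by
      intro μ ν
      refine ((hT μ ν).sub_const (Λ * eta μ ν)).congr' ?_
      filter_upwards [eventually_gt_atTop t₀] with t ht
      rw [hE t ht]
    have h1 : ∀ t, etaDiag a.succ * riemann e t a.succ 0 b.succ 0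
        = (∑ c : Fin 3, riemann e t c.succ a.succ c.succ b.succ) - ricci e t a.succ b.succ := by
      intro t
      rw [ricci_spatial, etaDiag_succ]
      ring
    have h2 : Tendsto (fun t => ∑ c : Fin 3, riemann e t c.succ a.succ c.succ b.succ) atTop _ :=
      tendsto_finsetSum _ fun c _ => gauss' c a c b
    have h3 : Tendsto (fun t => ricci e t a.succ b.succ) atTop
        (𝓝 ((0 - Λ * eta a.succ b.succ) - if a = b then (-(0 - Λ * eta 0 0)
          + ∑ c : Fin 3, (0 - Λ * eta c.succ c.succ)) / 2 else 0)) := by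
      simp only [ricci_spatial_of_einstein]
      refine (hEl _ _).sub ?_
      split_ifs
      · exact ((hEl 0 0).neg.add (tendsto_finsetSum _ fun c _ => hEl _ _)).div_const 2
      · exact tendsto_const_nhds
    simp only [h1]
    convert h2.sub h3 using 2
    simp only [etass, eta0s, etas0]
    by_cases hab : a = b
    · subst hab
      simp [eta, Fin.sum_univ_three]
      fin_cases a <;> simp <;> ring
    · simp only [eta, hab]
      simp only [Fin.sum_univ_three]
      fin_cases a <;> fin_cases b <;> simp at hab ⊢
  cases ρ using Fin.cases with
  | zero => cases σ using Fin.cases with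
    | zero => exact selfL _ _ _
    | succ b =>
      apply swapL
      cases μ using Fin.cases with
      | zero => cases ν using Fin.cases with
        | zero => exact selfR _ _ _
        | succ d => exact swapR (electric b d)
      | succ c => cases ν using Fin.cases with
        | zero => exact electric b c
        | succ d => exact codazzi b c d
  | succ a => cases σ using Fin.cases with
    | zero =>
      cases μ using Fin.cases with
      | zero => cases ν using Fin.cases with
        | zero => exact selfR _ _ _
        | succ d => exact swapR (electric a d)
      | succ c => cases ν using Fin.cases with
        | zero => exact electric a c
        | succ d => exact codazzi a c d
    | succ b =>
      cases μ using Fin.cases with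
      | zero => cases ν using Fin.cases with
        | zero => exact selfR _ _ _
        | succ d => exact mixed a b d
      | succ c => cases ν using Fin.cases with
        | zero => exact swapR (mixed a b c)
        | succ d => exact gauss a b c d

end Asymptotics

section Asymptotics

variable {𝔤 : Type*} [LieRing 𝔤] [LieAlgebra ℝ 𝔤] {e : ℝ → Module.Basis (Fin 3) ℝ 𝔤}
  {t₀ Λ κ C : ℝ} {T : ℝ → Fin 4 → Fin 4 → ℝ}

lemma deriv_hubble_le {t : ℝ} (hκ1 : κ ≤ 1)
    (he : ∀ (φ : Module.Dual ℝ 𝔤) (a : Fin 3), ContDiffOn ℝ 2 (fun t => φ (e t a)) (Set.Ioi t₀))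
    (ht : t₀ < t) (hn : IsNonperfect (spaceCoeff e t)) (hT : IsDecaying κ C (T t))
    (hE : ∀ μ ν, einstein e t μ ν = T t μ ν - Λ * eta μ ν) :
    deriv (hubble e) t ≤ -(κ * (hubble e t ^ 2 - Λ / 3)) := by
  have h1 := friedmann (hE 0 0)
  have h2 := raychaudhuri he ht hE
  have h3 := hn.spatialScalar_nonpos
  have h4 := hT.focus
  have h5 : 0 ≤ ∑ a, ∑ b, shear e t a b ^ 2 :=
    Finset.sum_nonneg fun a _ => Finset.sum_nonneg fun b _ => sq_nonneg _
  have h6 := mul_le_mul_of_nonneg_right hκ1 h5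
  have h7 := mul_le_mul_of_nonneg_right hκ1 (neg_nonneg.2 h3)
  have h8 : κ * (3 * hubble e t ^ 2 - Λ) = κ * (∑ a, ∑ b, shear e t a b ^ 2) / 2
      + κ * (-spatialScalar (spaceCoeff e t)) / 2 + κ * T t 0 0 := by
    rw [h1]; ring
  linarith

lemma le_sq_hubble {t : ℝ} (hn : IsNonperfect (spaceCoeff e t)) (hT : 0 ≤ T t 0 0)
    (hE : einstein e t 0 0 = T t 0 0 - Λ * eta 0 0) : Λ / 3 ≤ hubble e t ^ 2 := by
  have h1 := friedmann hE
  have h3 := hn.spatialScalar_nonpos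
  have h5 : 0 ≤ ∑ a, ∑ b, shear e t a b ^ 2 :=
    Finset.sum_nonneg fun a _ => Finset.sum_nonneg fun b _ => sq_nonneg _
  linarith

lemma sq_shear_le {t : ℝ} (hn : IsNonperfect (spaceCoeff e t)) (hT : 0 ≤ T t 0 0)
    (hE : einstein e t 0 0 = T t 0 0 - Λ * eta 0 0) (a b : Fin 3) :
    shear e t a b ^ 2 ≤ 2 * (3 * hubble e t ^ 2 - Λ) := by
  have h1 := friedmann hE
  have h3 := hn.spatialScalar_nonpos
  have h5 : shear e t a b ^ 2 ≤ ∑ a, ∑ b, shear e t a b ^ 2 :=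
    (Finset.single_le_sum (f := fun b => shear e t a b ^ 2) (fun b _ => sq_nonneg _)
      (Finset.mem_univ b)).trans
    (Finset.single_le_sum (f := fun a => ∑ b, shear e t a b ^ 2)
      (fun a _ => Finset.sum_nonneg fun b _ => sq_nonneg _) (Finset.mem_univ a))
  linarith

/-- The Hubble parameter either tends to `√(Λ/3)`, or it equals `-√(Λ/3)` from some time on:
a contracting model that is not of de Sitter type collapses in finite time. -/
lemma hubble_dichotomy (hΛ : 0 < Λ) (hκ : 0 < κ)
    (hd : ∀ t > t₀, DifferentiableAt ℝ (hubble e) t)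
    (hle : ∀ t > t₀, deriv (hubble e) t ≤ -(κ * (hubble e t ^ 2 - Λ / 3)))
    (hsq : ∀ t > t₀, Λ / 3 ≤ hubble e t ^ 2) :
    Tendsto (hubble e) atTop (𝓝 √(Λ / 3)) ∨ ∀ᶠ t in atTop, hubble e t = -√(Λ / 3) := by
  set k := √(Λ / 3) with hk
  have hk0 : 0 < k := Real.sqrt_pos.2 (by linarith)
  have hk2 : k ^ 2 = Λ / 3 := Real.sq_sqrt (by linarith)
  rw [← hk2] at hsq hle
  by_cases hpos : ∀ t > t₀, 0 < hubble e t
  · left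
    have hge : ∀ t > t₀, k ≤ hubble e t := fun t ht =>
      abs_le_of_sq_le_sq' (hsq t ht) (hpos t ht).le |>.2
    have := tendsto_zero_of_deriv_le (f := fun t => hubble e t - k) (f' := deriv (hubble e))
      (t₁ := t₀) (κ := κ * (2 * k)) (by positivity)
      (fun t ht => (hd t ht).hasDerivAt.sub_const k)
      (fun t ht => by
        have h1 := hge t ht
        have h2 := hle t ht
        have h3 : 0 ≤ κ * (hubble e t - k) ^ 2 := by positivity
        linarith)
      (fun t ht => by linarith [hge t ht])
    simpa using this.add_const k
  · right
    push Not at hpos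
    obtain ⟨t₁, ht₁, hneg⟩ := hpos
    have hanti : AntitoneOn (hubble e) (Set.Ioi t₀) := by
      refine antitoneOn_of_deriv_nonpos (convex_Ioi _)
        (fun t ht => (hd t ht).continuousAt.continuousWithinAt) ?_ ?_
      · intro t ht
        rw [interior_Ioi] at ht
        exact (hd t ht).differentiableWithinAt
      · intro t ht
        rw [interior_Ioi] at ht
        have h1 : 0 ≤ κ * (hubble e t ^ 2 - k ^ 2) :=
          mul_nonneg hκ.le (by linarith [hsq t ht])
        linarith [hle t ht]
    filter_upwards [eventually_gt_atTop t₁] with t₂ ht₂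
    by_contra hne
    have h2 : t₀ < t₂ := ht₁.trans ht₂
    have hlt : hubble e t₂ < -k := by
      have h3 := hanti (Set.mem_Ioi.2 ht₁) (Set.mem_Ioi.2 h2) ht₂.le
      have h4 := abs_le_of_sq_le_sq' (a := k) (b := -hubble e t₂)
        (by rw [neg_sq]; exact hsq t₂ h2) (by linarith)
      exact lt_of_le_of_ne (by linarith [h4.2]) hne
    have hall : ∀ t > t₂, hubble e t < -k := fun t ht =>
      (hanti (Set.mem_Ioi.2 h2) (Set.mem_Ioi.2 (h2.trans ht)) ht.le).trans_lt hlt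
    refine not_forall_sq_le_deriv (f := fun t => -hubble e t - k)
      (f' := fun t => -deriv (hubble e) t) (t₁ := t₂) hκ
      (fun t ht => ((hd t (h2.trans ht)).hasDerivAt.neg).sub_const k)
      (fun t ht => by linarith [hall t ht]) (fun t ht => ?_)
    have h3 := hle t (h2.trans ht)
    have h4 := hall t ht
    have h5 : 0 ≤ κ * (k * (-hubble e t - k)) :=
      mul_nonneg hκ.le (mul_nonneg hk0.le (by linarith))
    linarith

/-- In an expanding model with decaying shear the structure constants of the orthonormal frame
decay. -/
lemma tendsto_spaceCoeff
    (he : ∀ (φ : Module.Dual ℝ 𝔤) (a : Fin 3), ContDiffOn ℝ 2 (fun t => φ (e t a)) (Set.Ioi t₀))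
    {k : ℝ} (hk : 0 < k) (hH : Tendsto (hubble e) atTop (𝓝 k))
    (hσ : ∀ a b, Tendsto (fun t => shear e t a b) atTop (𝓝 0)) (a b c : Fin 3) :
    Tendsto (fun t => spaceCoeff e t a b c) atTop (𝓝 0) := by
  have hev : ∀ᶠ t in atTop, t₀ < t ∧ k / 2 < hubble e t ∧
      ∀ a b, |shear e t a b| < k / 108 := by
    refine (eventually_gt_atTop t₀).and ((hH.eventually (lt_mem_nhds (by linarith))).and ?_)
    rw [eventually_all]
    intro a
    rw [eventually_all]
    intro b
    have := (hσ a b).abs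
    rw [abs_zero] at this
    exact this.eventually (gt_mem_nhds (by positivity))
  obtain ⟨t₁, ht₁⟩ := eventually_atTop.1 hev
  have hy : Tendsto (fun t => ∑ a, ∑ b, ∑ c, spaceCoeff e t a b c ^ 2) atTop (𝓝 0) := by
    refine tendsto_zero_of_deriv_le (t₁ := t₁) (κ := k / 2) (by positivity)
      (fun t ht => hasDerivAt_sum_sq_spaceCoeff he (ht₁ t (le_of_lt ht)).1) (fun t ht => ?_)
      (fun t ht => by positivity)
    obtain ⟨h0, h1, h2⟩ := ht₁ t (le_of_lt ht)
    set y := ∑ a, ∑ b, ∑ c, spaceCoeff e t a b c ^ 2 with hy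
    have hy0 : 0 ≤ y := by positivity
    have hterm : ∀ (s p q : ℝ), |s| < k / 108 → |s * p * q| ≤ k / 216 * (p ^ 2 + q ^ 2) := by
      intro s p q hs
      rw [mul_assoc, abs_mul]
      have h3 : |p * q| ≤ (p ^ 2 + q ^ 2) / 2 := by
        rw [abs_le]
        constructor <;> nlinarith [sq_nonneg (p + q), sq_nonneg (p - q)]
      calc |s| * |p * q| ≤ k / 108 * ((p ^ 2 + q ^ 2) / 2) :=
            mul_le_mul hs.le h3 (abs_nonneg _) (by positivity)
        _ = _ := by ring
    have hbound : ∑ a, ∑ b, ∑ c, ∑ d, 2 * (shear e t a d * spaceCoeff e t a b c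
          * spaceCoeff e t d b c - shear e t d b * spaceCoeff e t a b c * spaceCoeff e t a d c
        - shear e t d c * spaceCoeff e t a b c * spaceCoeff e t a b d)
        ≤ ∑ a, ∑ b, ∑ c, ∑ d, k / 108 * (3 * spaceCoeff e t a b c ^ 2
          + spaceCoeff e t d b c ^ 2 + spaceCoeff e t a d c ^ 2 + spaceCoeff e t a b d ^ 2) := by
      refine Finset.sum_le_sum fun a _ => Finset.sum_le_sum fun b _ => Finset.sum_le_sum fun c _ =>
        Finset.sum_le_sum fun d _ => ?_
      have i1 := le_of_abs_le (hterm _ (spaceCoeff e t a b c) (spaceCoeff e t d b c) (h2 a d))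
      have i2 := neg_le_of_abs_le (hterm _ (spaceCoeff e t a b c) (spaceCoeff e t a d c) (h2 d b))
      have i3 := neg_le_of_abs_le (hterm _ (spaceCoeff e t a b c) (spaceCoeff e t a b d) (h2 d c))
      linarith
    have hsum : ∑ a, ∑ b, ∑ c, ∑ d, k / 108 * (3 * spaceCoeff e t a b c ^ 2
          + spaceCoeff e t d b c ^ 2 + spaceCoeff e t a d c ^ 2 + spaceCoeff e t a b d ^ 2)
        = k / 6 * y := by
      rw [hy]
      simp only [Fin.sum_univ_three]
      ring
    have h3 : k / 2 * y ≤ hubble e t * y := mul_le_mul_of_nonneg_right h1.le hy0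
    have h4 : 0 ≤ k * y := by positivity
    linarith
  refine tendsto_zero_of_sq_le (Eventually.of_forall fun t => ?_) hy
  exact (Finset.single_le_sum (f := fun c => spaceCoeff e t a b c ^ 2) (fun c _ => sq_nonneg _)
      (Finset.mem_univ c)).trans
    ((Finset.single_le_sum (f := fun b => ∑ c, spaceCoeff e t a b c ^ 2)
      (fun b _ => by positivity) (Finset.mem_univ b)).trans
    (Finset.single_le_sum (f := fun a => ∑ b, ∑ c, spaceCoeff e t a b c ^ 2)
      (fun a _ => by positivity) (Finset.mem_univ a)))

lemma tendsto_spatialRiemann (hc : ∀ a b c, Tendsto (fun t => spaceCoeff e t a b c) atTop (𝓝 0))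
    (a b i j : Fin 3) :
    Tendsto (fun t => spatialRiemann (spaceCoeff e t) a b i j) atTop (𝓝 0) := by
  have hG : ∀ a b c, Tendsto (fun t => spatialConn (spaceCoeff e t) a b c) atTop (𝓝 0) := by
    intro a b c
    simpa only [spatialConn, add_zero, sub_zero, zero_div] using
      ((hc a b c).sub ((hc c b a).add (hc b c a))).div_const 2
  simp only [spatialRiemann]
  rw [show (0 : ℝ) = ∑ l : Fin 3, (0 * 0 - 0 * 0 - 0 * 0) by simp]
  exact tendsto_finsetSum _ fun l _ => (((hG _ _ _).mul (hG _ _ _)).sub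
    ((hG _ _ _).mul (hG _ _ _))).sub ((hc _ _ _).mul (hG _ _ _))

theorem asymptoticallyDeSitter_of_isDecaying (hΛ : 0 < Λ) (hκ : 0 < κ) (hκ1 : κ ≤ 1)
    (he : ∀ (φ : Module.Dual ℝ 𝔤) (a : Fin 3), ContDiffOn ℝ 2 (fun t => φ (e t a)) (Set.Ioi t₀))
    (hn : ∀ t, IsNonperfect (spaceCoeff e t)) (hT : ∀ t > t₀, IsDecaying κ C (T t))
    (hE : ∀ t > t₀, ∀ μ ν, einstein e t μ ν = T t μ ν - Λ * eta μ ν) :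
    AsymptoticallyDeSitter e ∧ Tendsto (fun t => Λ / (3 * hubble e t ^ 2)) atTop (𝓝 1) := by
  have hdich := hubble_dichotomy hΛ hκ (fun t ht => differentiableAt_hubble he ht)
    (fun t ht => deriv_hubble_le hκ1 he ht (hn t) (hT t ht) (hE t ht))
    (fun t ht => le_sq_hubble (hn t) (hT t ht).nonneg (hE t ht 0 0))
  set k := √(Λ / 3) with hk
  have hk0 : 0 < k := Real.sqrt_pos.2 (by linarith)
  have hk2 : k ^ 2 = Λ / 3 := Real.sq_sqrt (by linarith)
  obtain ⟨h, hh2, hH⟩ : ∃ h, h ^ 2 = Λ / 3 ∧ Tendsto (hubble e) atTop (𝓝 h) := by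
    rcases hdich with h1 | h1
    · exact ⟨k, hk2, h1⟩
    · exact ⟨-k, by rw [neg_sq, hk2], tendsto_const_nhds.congr' (h1.mono fun t ht => ht.symm)⟩
  have hh0 : h ≠ 0 := by
    rintro rfl
    norm_num at hh2
    linarith
  have hgt := eventually_gt_atTop t₀
  have hD : Tendsto (fun t => 2 * (3 * hubble e t ^ 2 - Λ)) atTop (𝓝 0) := by
    have := (((hH.pow 2).const_mul 3).sub_const Λ).const_mul 2
    rwa [hh2, show 2 * (3 * (Λ / 3) - Λ) = 0 by ring] at this
  have hσ : ∀ a b, Tendsto (fun t => shear e t a b) atTop (𝓝 0) := fun a b =>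
    tendsto_zero_of_sq_le (hgt.mono fun t ht =>
      sq_shear_le (hn t) (hT t ht).nonneg (hE t ht 0 0) a b) hD
  have hσ2 : Tendsto (fun t => ∑ a, ∑ b, shear e t a b ^ 2) atTop (𝓝 0) := by
    have := tendsto_finsetSum Finset.univ fun a (_ : a ∈ Finset.univ) =>
      tendsto_finsetSum Finset.univ fun b (_ : b ∈ Finset.univ) => (hσ a b).pow 2
    simpa using this
  have hT00 : Tendsto (fun t => T t 0 0) atTop (𝓝 0) := by
    refine tendsto_of_tendsto_of_tendsto_of_le_of_le' tendsto_const_nhds hD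
      (hgt.mono fun t ht => (hT t ht).nonneg) (hgt.mono fun t ht => ?_)
    have h1 := friedmann (hE t ht 0 0)
    have h2 := (hn t).spatialScalar_nonpos
    have h3 : 0 ≤ ∑ a, ∑ b, shear e t a b ^ 2 := by positivity
    linarith [(hT t ht).nonneg]
  have hTl : ∀ μ ν, Tendsto (fun t => T t μ ν) atTop (𝓝 0) := by
    intro μ ν
    have h1 := hT00.const_mul C
    rw [mul_zero] at h1
    exact squeeze_zero_norm' (hgt.mono fun t ht => (hT t ht).bound μ ν) h1
  have hθ : ∀ a b, Tendsto (fun t => expansion e t a b) atTop (𝓝 (if a = b then h else 0)) := by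
    intro a b
    have h1 : Tendsto (fun t => shear e t a b + if a = b then hubble e t else 0) atTop
        (𝓝 (0 + if a = b then h else 0)) := by
      refine (hσ a b).add ?_
      split_ifs
      · exact hH
      · exact tendsto_const_nhds
    rw [zero_add] at h1
    refine h1.congr fun t => ?_
    rw [shear_eq]
    ring
  have hgeom : (∀ a b i j, Tendsto (fun t => spatialRiemann (spaceCoeff e t) a b i j) atTop (𝓝 0))
      ∧ ∀ a b c i j, Tendsto (fun t => spaceCoeff e t a b c * shear e t i j) atTop (𝓝 0) := by
    rcases hdich with h1 | h1
    · have hc := tendsto_spaceCoeff he hk0 h1 hσ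
      refine ⟨tendsto_spatialRiemann hc, fun a b c i j => ?_⟩
      simpa using (hc a b c).mul (hσ i j)
    · have hzero : ∀ᶠ t in atTop, (∀ i j, shear e t i j = 0) ∧
          spatialScalar (spaceCoeff e t) = 0 := by
        filter_upwards [h1, hgt] with t h2 ht
        have h3 : 3 * hubble e t ^ 2 - Λ = 0 := by rw [h2, neg_sq, hk2]; ring
        refine ⟨fun i j => ?_, ?_⟩
        · have h4 := sq_shear_le (hn t) (hT t ht).nonneg (hE t ht 0 0) i j
          rw [h3, mul_zero] at h4
          exact pow_eq_zero_iff two_ne_zero |>.1 (le_antisymm h4 (sq_nonneg _))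
        · have h4 := friedmann (hE t ht 0 0)
          have h5 := (hn t).spatialScalar_nonpos
          have h6 : 0 ≤ ∑ a, ∑ b, shear e t a b ^ 2 := by positivity
          linarith [(hT t ht).nonneg]
      refine ⟨fun a b i j => ?_, fun a b c i j => ?_⟩
      · exact tendsto_const_nhds.congr' (hzero.mono fun t ht =>
          ((hn t).spatialRiemann_eq_zero ht.2 a b i j).symm)
      · exact tendsto_const_nhds.congr' (hzero.mono fun t ht => by
          simp only [ht.1, mul_zero])
  have hscal : Tendsto (fun t => spatialScalar (spaceCoeff e t)) atTop (𝓝 0) := by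
    have := tendsto_finsetSum Finset.univ fun a (_ : a ∈ Finset.univ) =>
      tendsto_finsetSum Finset.univ fun b (_ : b ∈ Finset.univ) => hgeom.1 b a b a
    simpa [spatialScalar] using this
  have hdH : Tendsto (deriv (hubble e)) atTop (𝓝 0) := by
    have h1 := (((hσ2.const_mul (3 / 2)).sub (hscal.div_const 2)).add
      (((hT00.const_mul 3).add (tendsto_finsetSum Finset.univ fun (a : Fin 3) _ =>
        hTl a.succ a.succ)).div_const 2)).div_const (-3)
    simp only [mul_zero, zero_div, sub_zero, Finset.sum_const_zero, add_zero] at h1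
    refine h1.congr' ?_
    filter_upwards [hgt] with t ht
    rw [← raychaudhuri he ht (hE t ht)]
    ring
  refine ⟨⟨⟨Λ / 3, by positivity, tendsto_riemann he hE hTl hh2 hθ hgeom.1 hgeom.2⟩, ?_, ?_⟩, ?_⟩
  · intro a b
    have := (hσ a b).div hH hh0
    rwa [zero_div] at this
  · have := (hdH.div (hH.pow 2) (pow_ne_zero 2 hh0)).const_sub (-1)
    rwa [zero_div, sub_zero] at this
  · have := (tendsto_const_nhds (x := Λ)).div ((hH.pow 2).const_mul 3)
      (mul_ne_zero three_ne_zero (pow_ne_zero 2 hh0))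
    rwa [hh2, show Λ / (3 * (Λ / 3)) = 1 by field_simp] at this

end Asymptotics

end Bianchi

/-- Bianchi types I–VII_h are the three-dimensional real solvable Lie algebras. The form field has
degree `j = q + 1 ∈ {1, 3}`. -/
theorem theorem1 {𝔤 : Type*} [LieRing 𝔤] [LieAlgebra ℝ 𝔤] [LieAlgebra.IsSolvable 𝔤]
    {q : ℕ} (hj : q + 1 = 1 ∨ q + 1 = 3)
    (γ Λ t₀ : ℝ) (hγ : 0 ≤ γ) (hΛ : 0 < Λ)
    (e : ℝ → Module.Basis (Fin 3) ℝ 𝔤) (P : ℝ → (Fin (q + 1) → Fin 4) → ℝ)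
    (ρ : ℝ → ℝ) (U : ℝ → Fin 4 → ℝ)
    (hsol : Bianchi.IsCosmology γ Λ t₀ e P ρ U) :
    Bianchi.AsymptoticallyDeSitter e ∧
    (0 < γ → Tendsto (Bianchi.omegaLambda Λ e) atTop (𝓝 1)) ∧
    (γ = 0 → Tendsto (fun t => Bianchi.omegaLambda Λ e t + Bianchi.omegaFluid γ ρ U e t)
      atTop (𝓝 1)) := by
  have hn := Bianchi.isNonperfect_of_isSolvable e
  have hform : ∀ t > t₀, Bianchi.IsDecaying 1 3 (Bianchi.formT P t) := fun t ht =>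
    Bianchi.isDecaying_formT hj P t (hsol.form_alternating t ht)
  rcases hγ.eq_or_lt with rfl | hγ
  · obtain ⟨ρ₀, hρ₀⟩ : ∃ ρ₀, ∀ t > t₀, ρ t = ρ₀ := by
      refine ⟨ρ (t₀ + 1), fun t ht => ?_⟩
      exact isOpen_Ioi.is_const_of_deriv_eq_zero isPreconnected_Ioi
        (hsol.density_contDiff.differentiableOn (by norm_num))
        (fun s hs => Bianchi.deriv_density_eq_zero (hsol.fluid_conserved s hs ![0])) ht
        (Set.mem_Ioi.2 (by linarith))
    have hρ₀' : 0 ≤ ρ₀ := by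
      rw [← hρ₀ (t₀ + 1) (by linarith)]
      exact hsol.density_nonneg _ (by linarith)
    obtain ⟨h1, h2⟩ := Bianchi.asymptoticallyDeSitter_of_isDecaying (Λ := Λ + ρ₀)
      (by linarith) one_pos le_rfl hsol.frame_contDiff hn hform (fun t ht μ ν => by
        rw [hsol.einstein_eq t ht, Bianchi.fluidT_zero, hρ₀ t ht]
        ring)
    refine ⟨h1, fun h => absurd h (lt_irrefl _), fun _ => h2.congr' ?_⟩
    filter_upwards [eventually_gt_atTop t₀] with t ht
    rw [Bianchi.omegaLambda, Bianchi.omegaFluid, Bianchi.fluidT_zero, hρ₀ t ht, ← add_div]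
    simp [Bianchi.eta]
  · obtain ⟨h1, h2⟩ := Bianchi.asymptoticallyDeSitter_of_isDecaying hΛ
      (lt_min (lt_min one_pos (by positivity : 0 < 3 * γ / 2)) one_pos) (min_le_right _ _)
      hsol.frame_contDiff hn
      (fun t ht => (Bianchi.isDecaying_fluidT hγ (hsol.density_nonneg t ht)
        (hsol.velocity_unit t ht)).add (hform t ht))
      (fun t ht μ ν => hsol.einstein_eq t ht μ ν)
    exact ⟨h1, fun _ => h2, fun h => absurd h hγ.ne'⟩
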